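/- Let $q\in\mathbb{C}$ with $0<|q|<1$, fix a value of $\log q$, and write $q^{\beta}=e^{\beta\log q}$, $(a)_\infty=\prod_{k\ge0}(1-aq^k)$, $(a_1,\dots,a_n)_\infty=(a_1)_\infty\cdots(a_n)_\infty$ and $\theta(x)=(x,q/x)_\infty$. Let $\beta_1,\dots,\beta_M,\gamma\in\mathbb{C}$, $b_i=q^{\beta_i}$, $c=q^{\gamma}$. For $1\le r\le M-1$ let $\tilde S_r(\{b_i\},c;u)$ be the $M\times M$ matrix $$\tilde S_r=\begin{pmatrix} I_{r-1}&&&\\&\tilde S_{r,r}&\tilde S_{r,r+1}&\\&\tilde S_{r+1,r}&\tilde S_{r+1,r+1}&\\&&&I_{M-r-1}\end{pmatrix}$$ (zero in the blank places) with entries $$\tilde S_{r,r}=\frac{(q/b_{r+1},\,b_r)_\infty}{\bigl(q^2b_rb_{r+2}\cdots b_M/c,\ c/(qb_{r+1}\cdots b_M)\bigr)_\infty}\,\frac{\theta\bigl(uc/(qb_{r+1}\cdots b_M)\bigr)}{\theta(ub_r)}\,u^{-1-\sum_{i=r}^M\beta_i+\gamma},$$ $$\tilde S_{r,r+1}=\frac{(q^2b_{r+2}\cdots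 b_M/c,\ qb_r\cdots b_M/c)_\infty}{(q^2b_rb_{r+2}\cdots b_M/c,\ qb_{r+1}\cdots b_M/c)_\infty}\,\frac{\theta(u)}{\theta(ub_r)}\,u^{-\beta_r},$$ $$\tilde S_{r+1,r}=\frac{\bigl(c/(b_r\cdots b_M),\ c/(qb_{r+2}\cdots b_M)\bigr)_\infty}{\bigl(c/(b_rb_{r+2}\cdots b_M),\ c/(qb_{r+1}\cdots b_M)\bigr)_\infty}\,\frac{\theta(ub_r/b_{r+1})}{\theta(ub_r)}\,u^{-\beta_{r+1}},$$ $$\tilde S_{r+1,r+1}=\frac{(q/b_r,\,b_{r+1})_\infty}{\bigl(c/(b_rb_{r+2}\cdots b_M),\ qb_{r+1}\cdots b_M/c\bigr)_\infty}\,\frac{\theta(uqb_rb_{r+2}\cdots b_M/c)}{\theta(ub_r)}\,u^{1+\sum_{i=r+2}^M\beta_i-\gamma}.$$ Here powers are taken with respect to a chosen logarithm, $u^\delta=e^{\delta\log u}$. Assume $c/\prod_{i\in I}b_i\notin q^{\mathbb{Z}}$ for every $I\subseteq\{1,\dots,M\}$. Let $1\le r\le M-2$, let $s_r=(r,r+1)$,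 and for a permutation $\sigma$ of $\{1,\dots,M\}$ write $b_\sigma=\{b_{\sigma(i)}\}_{1\le i\le M}$ (with exponents $\beta_{\sigma(i)}$). Products of permutations are read from left to right, so that $(s_{r+1}s_r)(i)=s_r(s_{r+1}(i))$. Then the Yang–Baxter equation $$\tilde S_r(b_{s_{r+1}s_r},c;u)\,\tilde S_{r+1}(b_{s_r},c;uv)\,\tilde S_r(b,c;v)=\tilde S_{r+1}(b_{s_rs_{r+1}},c;v)\,\tilde S_r(b_{s_{r+1}},c;uv)\,\tilde S_{r+1}(b,c;u)$$ holds for all nonzero $u,v\in\mathbb{C}$ at which none of these matrices has a pole, that is, $ub_{r+1},\ vb_r,\ uvb_r\notin q^{\mathbb{Z}}$, for every choice of $\log u$ and $\log v$, with $\log(uv)=\log u+\log v$. -/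

import Mathlib

noncomputable section

/-- The infinite `q`-shifted factorial `(a)_∞ = ∏_{k ≥ 0} (1 - a q^k)`. -/
def qPoch (q a : ℂ) : ℂ := ∏' k : ℕ, (1 - a * q ^ k)

/-- The theta function `θ(x) = (x)_∞ (q/x)_∞`. -/
def qTheta (q x : ℂ) : ℂ := qPoch q x * qPoch q (q / x)

/-- The power `q ^ β = exp (β log q)`, where `lq` is the chosen value of `log q`. -/
def qPow (lq β : ℂ) : ℂ := Complex.exp (lq * β)

/-- The adjacent transposition `s_r`, exchanging the positions `r` and `r + 1`
(positions are counted from `0`). -/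
def adjSwap {M : ℕ} (r : ℕ) (hr : r + 1 < M) : Equiv.Perm (Fin M) :=
  Equiv.swap ⟨r, by omega⟩ ⟨r + 1, hr⟩

/-- The matrix `S̃_r({b_i}, c; u)` of size `M` with `b_i = q ^ β_i`, `c = q ^ γ`.
The entries contain complex powers of `u`, so the matrix is a function of a logarithm `x` of `u`:
`u = exp x` and `u ^ δ = exp (δ x)`. Positions are counted from `0`; the `2 × 2` block sits in the
rows and columns `r`, `r + 1`, and the matrix is the identity elsewhere. Below, `b₀`, `b₁` are
the parameters at the positions `r`, `r + 1`, while `p` and `s` are the product of the `b_i` and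
the sum of the `β_i` over all positions `i` after `r + 1`. -/
def STilde {M : ℕ} (lq : ℂ) (β : Fin M → ℂ) (γ : ℂ) (r : ℕ) (hr : r + 1 < M) (x : ℂ) :
    Matrix (Fin M) (Fin M) ℂ :=
  let q : ℂ := Complex.exp lq
  let c : ℂ := qPow lq γ
  let u : ℂ := Complex.exp x
  let β₀ : ℂ := β ⟨r, by omega⟩
  let β₁ : ℂ := β ⟨r + 1, hr⟩
  let b₀ : ℂ := qPow lq β₀
  let b₁ : ℂ := qPow lq β₁
  let p : ℂ := ∏ i : Fin M with r + 1 < i.val, qPow lq (β i)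
  let s : ℂ := ∑ i : Fin M with r + 1 < i.val, β i
  Matrix.of fun i j =>
    if i.val = r ∧ j.val = r then
      (qPoch q (q / b₁) * qPoch q b₀) /
          (qPoch q (q ^ 2 * b₀ * p / c) * qPoch q (c / (q * b₁ * p))) *
        (qTheta q (u * c / (q * b₁ * p)) / qTheta q (u * b₀)) *
        Complex.exp ((-1 - (β₀ + β₁ + s) + γ) * x)
    else if i.val = r ∧ j.val = r + 1 then
      (qPoch q (q ^ 2 * p / c) * qPoch q (q * b₀ * b₁ * p / c)) /
          (qPoch q (q ^ 2 * b₀ * p / c) * qPoch q (q * b₁ * p / c)) *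
        (qTheta q u / qTheta q (u * b₀)) *
        Complex.exp (-β₀ * x)
    else if i.val = r + 1 ∧ j.val = r then
      (qPoch q (c / (b₀ * b₁ * p)) * qPoch q (c / (q * p))) /
          (qPoch q (c / (b₀ * p)) * qPoch q (c / (q * b₁ * p))) *
        (qTheta q (u * b₀ / b₁) / qTheta q (u * b₀)) *
        Complex.exp (-β₁ * x)
    else if i.val = r + 1 ∧ j.val = r + 1 then
      (qPoch q (q / b₀) * qPoch q b₁) /
          (qPoch q (c / (b₀ * p)) * qPoch q (q * b₁ * p / c)) *
        (qTheta q (u * q * b₀ * p / c) / qTheta q (u * b₀)) *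
        Complex.exp ((1 + s - γ) * x)
    else if i = j then 1
    else 0

end

open Filter Topology Complex

/-! Write `b_i = exp B_i` and `exp d = c / (q ∏ b_i)`, the product running over the positions after
the three affected ones. The infinite products in the entries of `S̃` that involve `c` are halves of
theta functions, and a diagonal gauge completes them: on the three positions each factor becomes
`diag(h)⁻¹ F diag(g)`, where `F` depends on `d` through theta functions only and `h` is `g` with two
parameters exchanged (`STilde_upper`, `STilde_lower`). On each side of the equation the inner gauges
cancel and the outer ones agree. What remains is a 3 × 3 dynamical Yang–Baxter equation,
`face_yangBaxter`, in which `d` is shifted by the parameter of the idle position when that position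
lies to the right.

Let `σ(z) = e^{-z/2} θ(e^z)`. Of the nine matrix entries, six are single instances of the
Weierstrass three-term relation, the central one is a combination of two instances, and two corners
are mere cancellations.

The Weierstrass relation holds because `σ(x+y) σ(x-y) = f(x) g(y) - g(x) f(y)`
(`exists_sigmaTheta_eq_det`): it is then the Plücker relation for 2 × 2 minors. The determinant
comes from the Jacobi triple product, by multiplying two theta series and sorting the terms by
parity; the triple product itself is the limit of a finite identity proved by induction. -/

/-! ### Infinite q-shifted factorials -/

theorem summable_norm_mul_pow {q : ℂ} (hq : ‖q‖ < 1) (a : ℂ) :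
    Summable fun k : ℕ => ‖-(a * q ^ k)‖ := by
  simp only [norm_neg, norm_mul, norm_pow]
  exact (summable_geometric_of_lt_one (norm_nonneg _) hq).mul_left _

theorem multipliable_one_sub_mul_pow {q : ℂ} (hq : ‖q‖ < 1) (a : ℂ) :
    Multipliable fun k : ℕ => 1 - a * q ^ k := by
  simpa only [sub_eq_add_neg] using multipliable_one_add_of_summable (summable_norm_mul_pow hq a)

theorem tendsto_prod_qPoch {q : ℂ} (hq : ‖q‖ < 1) (a : ℂ) :
    Tendsto (fun n => ∏ k ∈ Finset.range n, (1 - a * q ^ k)) atTop (𝓝 (qPoch q a)) :=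
  (multipliable_one_sub_mul_pow hq a).hasProd.tendsto_prod_nat

theorem qPoch_ne_zero {q a : ℂ} (hq : ‖q‖ < 1) (h : ∀ k : ℕ, a * q ^ k ≠ 1) :
    qPoch q a ≠ 0 := by
  have := tprod_one_add_ne_zero_of_summable (f := fun k : ℕ => -(a * q ^ k))
    (fun k => by rw [← sub_eq_add_neg, sub_ne_zero]; exact (h k).symm) (summable_norm_mul_pow hq a)
  simp only [← sub_eq_add_neg] at this
  exact this

theorem qPoch_eq_one_sub_mul {q : ℂ} (hq : ‖q‖ < 1) (a : ℂ) :
    qPoch q a = (1 - a) * qPoch q (a * q) := by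
  have h : Multipliable fun k : ℕ => 1 - a * q ^ (k + 1) := by
    refine (multipliable_one_sub_mul_pow hq (a * q)).congr fun k => ?_
    rw [pow_succ', mul_assoc]
  have e : ∀ k : ℕ, 1 - a * q * q ^ k = 1 - a * q ^ (k + 1) := fun k => by ring
  unfold qPoch
  simp only [e]
  rw [tprod_eq_zero_mul' (f := fun k : ℕ => 1 - a * q ^ k) h, pow_zero, mul_one]

theorem norm_exp_lt_one {l : ℂ} (hl : l.re < 0) : ‖exp l‖ < 1 := by
  rw [norm_exp]; exact (Real.exp_lt_exp.mpr hl).trans_eq Real.exp_zero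

/-! ### Theta series and the Jacobi triple product -/

/-- The terms of a theta series with a Gaussian exponent of negative real part are summable. -/
theorem summable_exp_quadratic {a : ℂ} (ha : a.re < 0) (b : ℂ) :
    Summable fun j : ℤ => exp (a * j ^ 2 + b * j) := by
  have hpi : (Real.pi : ℂ) ≠ 0 := by exact_mod_cast Real.pi_ne_zero
  -- The modulus `τ` with `πiτ = a`; its imaginary part is `-Re a / π`.
  have him : 0 < (a / (Real.pi * I)).im := by
    have : a / (Real.pi * I) = ((Real.pi⁻¹ : ℝ) : ℂ) * (-(a * I)) := by
      push_cast
      field_simp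
      rw [I_sq]
      ring
    rw [this, im_ofReal_mul]
    simp only [neg_im, mul_im, I_re, I_im, mul_zero, mul_one, add_zero]
    have := Real.pi_pos
    have : 0 < Real.pi⁻¹ := inv_pos.mpr this
    nlinarith
  refine ((summable_jacobiTheta₂_term_iff (b / (2 * Real.pi * I)) _).mpr him).congr fun j => ?_
  unfold jacobiTheta₂_term
  congr 1
  field_simp
  ring

/-- The `j`-th term `(-1)^j q^{j(j-1)/2} x^j` of the theta series, with `q = exp l`, `x = exp z`. -/
noncomputable def thetaTerm (l z : ℂ) (j : ℤ) : ℂ :=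
  exp (l * (j * (j - 1) / 2) + j * (z + Real.pi * I))

theorem summable_thetaTerm {l : ℂ} (hl : l.re < 0) (z : ℂ) : Summable (thetaTerm l z) := by
  have h2 : (l / 2).re < 0 := by
    rw [show l / 2 = ((2⁻¹ : ℝ) : ℂ) * l by push_cast; ring, re_ofReal_mul]
    linarith
  refine (summable_exp_quadratic h2 (z + Real.pi * I - l / 2)).congr fun j => ?_
  unfold thetaTerm
  congr 1
  ring

theorem exp_mul_thetaTerm_sub_one (l z : ℂ) (j : ℤ) :
    exp z * thetaTerm l z (j - 1) = -(exp (-(l * (j - 1))) * thetaTerm l z j) := by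
  unfold thetaTerm
  rw [← exp_add, ← exp_add, ← mul_neg_one, ← exp_pi_mul_I, ← exp_add, exp_eq_exp_iff_exists_int]
  -- The signs give `(j-1)πi` on the left and `jπi + πi` on the right, one full period apart.
  refine ⟨-1, ?_⟩
  push_cast
  ring

theorem thetaTerm_add_one_div_exp (l z : ℂ) (j : ℤ) :
    thetaTerm l z (j + 1) / exp z = -(exp (l * j) * thetaTerm l z j) := by
  unfold thetaTerm
  rw [← exp_sub, ← exp_add, ← mul_neg_one, ← exp_pi_mul_I, ← exp_add]
  congr 1
  push_cast
  ring

/-- The reciprocal `1 / (q)_m` of the `q`-factorial, extended by zero to negative `m`. -/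
noncomputable def qFactInv (q : ℂ) (m : ℤ) : ℂ :=
  if m < 0 then 0 else (∏ k ∈ Finset.range m.toNat, (1 - q * q ^ k))⁻¹

theorem qFactInv_natCast (q : ℂ) (m : ℕ) :
    qFactInv q m = (∏ k ∈ Finset.range m, (1 - q * q ^ k))⁻¹ := by
  simp [qFactInv]

theorem mul_pow_ne_one {q : ℂ} (hq : ‖q‖ < 1) (k : ℕ) : q * q ^ k ≠ 1 := by
  intro h
  have := congrArg norm h
  rw [← pow_succ', norm_pow, norm_one] at this
  exact (pow_lt_one₀ (norm_nonneg q) hq k.succ_ne_zero).ne this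

/-- At `m = 0` the factor `1 - q^0` vanishes, so the recursion survives the extension by zero. Sums
over all of `ℤ` can therefore be shifted without boundary terms. -/
theorem qFactInv_sub_one {q : ℂ} (hq : ‖q‖ < 1) (m : ℤ) :
    qFactInv q (m - 1) = (1 - q ^ m) * qFactInv q m := by
  rcases lt_trichotomy m 0 with h | rfl | h
  · simp [qFactInv, h, show m - 1 < 0 by omega]
  · simp [qFactInv]
  · obtain ⟨n, rfl⟩ : ∃ n : ℕ, m = n + 1 := ⟨(m - 1).toNat, by omega⟩
    have h1 : (n : ℤ) + 1 - 1 = n := by ring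
    have h2 : 1 - q * q ^ n ≠ 0 := sub_ne_zero.mpr (mul_pow_ne_one hq n).symm
    rw [h1, show (n : ℤ) + 1 = ((n + 1 : ℕ) : ℤ) by push_cast; rfl, qFactInv_natCast,
      qFactInv_natCast, Finset.prod_range_succ, zpow_natCast, pow_succ']
    field_simp

/-- The finite form of the Jacobi triple product. -/
theorem hasSum_finite_tripleProduct {l : ℂ} (hl : l.re < 0) (z : ℂ) (n : ℕ) :
    HasSum (fun j : ℤ => (∏ k ∈ Finset.range (2 * n), (1 - exp l * exp l ^ k)) *
        qFactInv (exp l) (n + j) * qFactInv (exp l) (n - j) * thetaTerm l z j)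
      ((∏ k ∈ Finset.range n, (1 - exp z * exp l ^ k)) *
        ∏ k ∈ Finset.range n, (1 - exp l / exp z * exp l ^ k)) := by
  have hq := norm_exp_lt_one hl
  induction n with
  | zero =>
    have h0 : ∀ j : ℤ, j ≠ 0 → qFactInv (exp l) j * qFactInv (exp l) (-j) = 0 := by
      intro j hj
      rcases lt_or_gt_of_ne hj with h | h
      · simp [qFactInv, h]
      · simp [qFactInv, h]
    convert hasSum_single (α := ℂ) (0 : ℤ) ?_ using 1
    · simp [qFactInv, thetaTerm]
    · intro j hj
      simp [h0 j hj]
  | succ n ih =>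
    -- With `x = exp z`, the new factor is `(1 - x q^n)(1 - q^{n+1}/x) = 1 + q^{2n+1} - q^n x -
    -- q^{n+1}/x`. Multiplication by `x` or `1/x` shifts the summation index.
    have H0 := ih.mul_left (1 + exp l * exp l ^ (2 * n))
    have H1 := (((Equiv.subRight (1 : ℤ)).hasSum_iff).mpr ih).mul_left (-exp l ^ n * exp z)
    have H2 := (((Equiv.addRight (1 : ℤ)).hasSum_iff).mpr ih).mul_left
      (-exp l * exp l ^ n / exp z)
    have hval : (∏ k ∈ Finset.range (n + 1), (1 - exp z * exp l ^ k)) *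
        ∏ k ∈ Finset.range (n + 1), (1 - exp l / exp z * exp l ^ k) =
        (1 + exp l * exp l ^ (2 * n)) * ((∏ k ∈ Finset.range n, (1 - exp z * exp l ^ k)) *
          ∏ k ∈ Finset.range n, (1 - exp l / exp z * exp l ^ k)) +
        -exp l ^ n * exp z * ((∏ k ∈ Finset.range n, (1 - exp z * exp l ^ k)) *
          ∏ k ∈ Finset.range n, (1 - exp l / exp z * exp l ^ k)) +
        -exp l * exp l ^ n / exp z * ((∏ k ∈ Finset.range n, (1 - exp z * exp l ^ k)) *
          ∏ k ∈ Finset.range n, (1 - exp l / exp z * exp l ^ k)) := by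
      have hz := exp_ne_zero z
      rw [Finset.prod_range_succ, Finset.prod_range_succ, two_mul, pow_add]
      generalize (∏ k ∈ Finset.range n, (1 - exp z * exp l ^ k)) = P₁
      generalize (∏ k ∈ Finset.range n, (1 - exp l / exp z * exp l ^ k)) = P₂
      field_simp
      ring
    rw [hval]
    refine Eq.subst (motive := fun f : ℤ → ℂ => HasSum f _) (funext fun j => Eq.symm ?_)
      ((H0.add H1).add H2)
    simp only [Function.comp, Equiv.subRight_apply, Equiv.coe_addRight]
    have e1 := exp_mul_thetaTerm_sub_one l z j
    have e2 := thetaTerm_add_one_div_exp l z j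
    -- All reciprocals are reduced to those of `(q)_{n+1+j}` and `(q)_{n+1-j}`, which leaves a
    -- polynomial identity in `q`, `q^{n+j}` and `q^{n-j}`.
    have ha := qFactInv_sub_one hq (n + 1 + j)
    have ha' := qFactInv_sub_one hq (n + j)
    have hb := qFactInv_sub_one hq (n + 1 - j)
    have hb' := qFactInv_sub_one hq (n - j)
    have s1 : (n : ℤ) + 1 + j - 1 = n + j := by ring
    have s2 : (n : ℤ) + 1 - j - 1 = n - j := by ring
    rw [s1] at ha
    rw [s2] at hb
    rw [ha] at ha'
    rw [hb] at hb'
    have t1 : (n : ℤ) + (j - 1) = n + j - 1 := by ring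
    have t2 : (n : ℤ) - (j - 1) = n + 1 - j := by ring
    have t3 : (n : ℤ) + (j + 1) = n + 1 + j := by ring
    have t4 : (n : ℤ) - (j + 1) = n - j - 1 := by ring
    have z1 : exp l ^ ((n : ℤ) + 1 + j) = exp l ^ ((n : ℤ) + j) * exp l := by
      rw [← zpow_add_one₀ (exp_ne_zero l)]; congr 1; ring
    have z2 : exp l ^ ((n : ℤ) + 1 - j) = exp l ^ ((n : ℤ) - j) * exp l := by
      rw [← zpow_add_one₀ (exp_ne_zero l)]; congr 1; ring
    have z3 : exp l ^ n * exp (-(l * (j - 1))) = exp l ^ ((n : ℤ) - j) * exp l := by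
      rw [← exp_nat_mul, ← exp_int_mul, ← exp_add, ← exp_add]; congr 1; push_cast; ring
    have z4 : exp l ^ n * exp (l * j) = exp l ^ ((n : ℤ) + j) := by
      rw [← exp_nat_mul, ← exp_int_mul, ← exp_add]; congr 1; push_cast; ring
    have z5 : exp l ^ (2 * n) = exp l ^ ((n : ℤ) + j) * exp l ^ ((n : ℤ) - j) := by
      rw [← zpow_add₀ (exp_ne_zero l), ← zpow_natCast]; congr 1; push_cast; ring
    rw [t1, t2, t3, t4, ha', hb', ha, hb, show 2 * (n + 1) = 2 * n + 1 + 1 by ring,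
      Finset.prod_range_succ, Finset.prod_range_succ, pow_succ (exp l) (2 * n), z5, z1, z2,
      Nat.cast_succ]
    linear_combination
      exp l ^ n * ((∏ k ∈ Finset.range (2 * n), (1 - exp l * exp l ^ k)) *
        ((1 - exp l ^ ((n : ℤ) + j)) * ((1 - exp l ^ ((n : ℤ) + j) * exp l) *
          qFactInv (exp l) (n + 1 + j))) * qFactInv (exp l) (n + 1 - j)) * e1 -
      (∏ k ∈ Finset.range (2 * n), (1 - exp l * exp l ^ k)) *
        ((1 - exp l ^ ((n : ℤ) + j)) * ((1 - exp l ^ ((n : ℤ) + j) * exp l) *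
          qFactInv (exp l) (n + 1 + j))) * qFactInv (exp l) (n + 1 - j) * thetaTerm l z j * z3 +
      exp l * exp l ^ n * ((∏ k ∈ Finset.range (2 * n), (1 - exp l * exp l ^ k)) *
        qFactInv (exp l) (n + 1 + j) * ((1 - exp l ^ ((n : ℤ) - j)) *
          ((1 - exp l ^ ((n : ℤ) - j) * exp l) * qFactInv (exp l) (n + 1 - j)))) * e2 -
      exp l * (∏ k ∈ Finset.range (2 * n), (1 - exp l * exp l ^ k)) *
        qFactInv (exp l) (n + 1 + j) * ((1 - exp l ^ ((n : ℤ) - j)) *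
          ((1 - exp l ^ ((n : ℤ) - j) * exp l) * qFactInv (exp l) (n + 1 - j))) *
        thetaTerm l z j * z4

theorem qPoch_self_ne_zero {q : ℂ} (hq : ‖q‖ < 1) : qPoch q q ≠ 0 :=
  qPoch_ne_zero hq (mul_pow_ne_one hq)

theorem tendsto_qFactInv_natCast {q : ℂ} (hq : ‖q‖ < 1) :
    Tendsto (fun n : ℕ => qFactInv q n) atTop (𝓝 (qPoch q q)⁻¹) := by
  simp only [qFactInv_natCast]
  exact (tendsto_prod_qPoch hq q).inv₀ (qPoch_self_ne_zero hq)

theorem tendsto_qFactInv {q : ℂ} (hq : ‖q‖ < 1) :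
    Tendsto (qFactInv q) atTop (𝓝 (qPoch q q)⁻¹) := by
  have h : Tendsto Int.toNat atTop atTop :=
    tendsto_atTop.mpr fun b => (eventually_ge_atTop (b : ℤ)).mono fun m hm => by omega
  refine ((tendsto_qFactInv_natCast hq).comp h).congr' ?_
  filter_upwards [eventually_ge_atTop 0] with m hm
  simp [Int.toNat_of_nonneg hm]

/-- Supplies the dominating constant for letting `n → ∞` in the finite triple product. -/
theorem exists_norm_qFactInv_le {q : ℂ} (hq : ‖q‖ < 1) : ∃ K, ∀ m : ℤ, ‖qFactInv q m‖ ≤ K := by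
  obtain ⟨K, hK⟩ :=
    (Metric.isBounded_range_of_tendsto _ (tendsto_qFactInv_natCast hq)).exists_norm_le
  refine ⟨K, fun m => ?_⟩
  rcases lt_or_ge m 0 with h | h
  · simpa [qFactInv, h] using (norm_nonneg _).trans (hK _ ⟨0, rfl⟩)
  · exact hK _ ⟨m.toNat, by simp [Int.toNat_of_nonneg h]⟩

/-- The **Jacobi triple product** `(q)_∞ θ(x) = ∑ (-1)^j q^{j(j-1)/2} x^j`. -/
theorem jacobi_tripleProduct {l : ℂ} (hl : l.re < 0) (z : ℂ) :
    qPoch (exp l) (exp l) * qTheta (exp l) (exp z) = ∑' j : ℤ, thetaTerm l z j := by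
  have hq := norm_exp_lt_one hl
  have hQ := qPoch_self_ne_zero hq
  obtain ⟨K, hK⟩ := exists_norm_qFactInv_le hq
  have hK0 : 0 ≤ K := (norm_nonneg _).trans (hK 0)
  have hprod : Tendsto (fun n : ℕ => ∏ k ∈ Finset.range (2 * n), (1 - exp l * exp l ^ k)) atTop
      (𝓝 (qPoch (exp l) (exp l))) :=
    (tendsto_prod_qPoch hq (exp l)).comp (tendsto_id.const_mul_atTop' two_pos)
  obtain ⟨N, hN⟩ := (Metric.isBounded_range_of_tendsto _ hprod).exists_norm_le
  have hN0 : 0 ≤ N := (norm_nonneg _).trans (hN _ ⟨0, rfl⟩)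
  have h1 : Tendsto (fun n : ℕ => (∏ k ∈ Finset.range n, (1 - exp z * exp l ^ k)) *
      ∏ k ∈ Finset.range n, (1 - exp l / exp z * exp l ^ k)) atTop
      (𝓝 (qTheta (exp l) (exp z))) :=
    (tendsto_prod_qPoch hq _).mul (tendsto_prod_qPoch hq _)
  -- The coefficient `(q)_{2n} / ((q)_{n+j} (q)_{n-j})` tends to `1/(q)_∞` for fixed `j` and is
  -- bounded uniformly in `n` and `j`.
  have h2 := tendsto_tsum_of_dominated_convergence (𝓕 := atTop)
    (f := fun (n : ℕ) (j : ℤ) => (∏ k ∈ Finset.range (2 * n), (1 - exp l * exp l ^ k)) *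
        qFactInv (exp l) (n + j) * qFactInv (exp l) (n - j) * thetaTerm l z j)
    (g := fun j => qPoch (exp l) (exp l) * (qPoch (exp l) (exp l))⁻¹ *
        (qPoch (exp l) (exp l))⁻¹ * thetaTerm l z j)
    (bound := fun j => N * K * K * ‖thetaTerm l z j‖)
    ((summable_thetaTerm hl z).norm.mul_left _)
    (fun j => by
      have c1 : Tendsto (fun n : ℕ => (n : ℤ) + j) atTop atTop :=
        tendsto_atTop_add_const_right _ _ tendsto_natCast_atTop_atTop
      have c2 : Tendsto (fun n : ℕ => (n : ℤ) - j) atTop atTop :=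
        tendsto_atTop_add_const_right _ (-j) tendsto_natCast_atTop_atTop
      exact ((hprod.mul ((tendsto_qFactInv hq).comp c1)).mul
        ((tendsto_qFactInv hq).comp c2)).mul_const _)
    (Eventually.of_forall fun n j => by
      simp only [norm_mul]
      gcongr
      · exact hN _ ⟨n, rfl⟩
      · exact hK _
      · exact hK _)
  simp only [(hasSum_finite_tripleProduct hl z _).tsum_eq] at h2
  rw [tendsto_nhds_unique h1 h2, tsum_mul_left]
  field_simp

/-! ### Products of two theta series and the Weierstrass identity -/

/-- Pairs of integers, classified by the parity of their sum. -/
def intProdParityEquiv : (ℤ × ℤ) ⊕ (ℤ × ℤ) ≃ ℤ × ℤ where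
  toFun := Sum.elim (fun p => (p.1 + 1 + p.2, p.1 + 1 - p.2)) (fun p => (p.1 + 1 + p.2, p.1 - p.2))
  invFun p := if (p.1 + p.2) % 2 = 0 then Sum.inl ((p.1 + p.2) / 2 - 1, (p.1 - p.2) / 2)
    else Sum.inr ((p.1 + p.2) / 2, (p.1 - p.2) / 2)
  left_inv := by
    rintro (⟨k, j⟩ | ⟨k, j⟩)
    · have : (k + 1 + j + (k + 1 - j)) % 2 = 0 := by omega
      simp only [Sum.elim_inl, this, if_true, Sum.inl.injEq, Prod.mk.injEq]
      omega
    · have : (k + 1 + j + (k - j)) % 2 ≠ 0 := by omega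
      simp only [Sum.elim_inr, this, if_false, Sum.inr.injEq, Prod.mk.injEq]
      omega
  right_inv := by
    rintro ⟨m, n⟩
    by_cases h : (m + n) % 2 = 0
    · simp only [h, if_true, Sum.elim_inl, Prod.mk.injEq]
      omega
    · simp only [h, if_false, Sum.elim_inr, Prod.mk.injEq]
      omega

/-- The even theta series `∑ q^{j²} y^{2j}`. -/
noncomputable def thetaEven (l y : ℂ) : ℂ := ∑' j : ℤ, exp (l * j ^ 2 + 2 * j * y)

/-- The odd theta series `∑ q^{j²+j} y^{2j+1}`. -/
noncomputable def thetaOdd (l y : ℂ) : ℂ := ∑' j : ℤ, exp (l * (j ^ 2 + j) + (2 * j + 1) * y)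

theorem summable_thetaEven {l : ℂ} (hl : l.re < 0) (y : ℂ) :
    Summable fun j : ℤ => exp (l * j ^ 2 + 2 * j * y) :=
  (summable_exp_quadratic hl (2 * y)).congr fun j => by congr 1; ring

theorem summable_thetaOdd {l : ℂ} (hl : l.re < 0) (y : ℂ) :
    Summable fun j : ℤ => exp (l * (j ^ 2 + j) + (2 * j + 1) * y) :=
  ((summable_exp_quadratic hl (l + 2 * y)).mul_left (exp y)).congr fun j => by
    rw [← exp_add]; congr 1; ring

theorem hasSum_mul_prod {f g : ℤ → ℂ} (hf : Summable f) (hg : Summable g) :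
    HasSum (fun p : ℤ × ℤ => f p.1 * g p.2) ((∑' j, f j) * ∑' j, g j) :=
  hf.hasSum.mul hg.hasSum (summable_mul_of_summable_norm hf.norm hg.norm)

/-- In the coordinates `m + n`, `m - n` the quadratic form of the double series separates, with `x`
coupled to the sum and `y` to the difference. Both have the same parity, and the sign `(-1)^{m+n}`
distinguishes the two classes. -/
theorem tsum_thetaTerm_mul_tsum_thetaTerm {l : ℂ} (hl : l.re < 0) (x y : ℂ) :
    (∑' j : ℤ, thetaTerm l (x + y) j) * ∑' j : ℤ, thetaTerm l (x - y) j =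
      exp x * (thetaOdd l x * thetaEven l y - thetaEven l x * thetaOdd l y) := by
  have h1 := hasSum_mul_prod (summable_thetaTerm hl (x + y)) (summable_thetaTerm hl (x - y))
  have h2 := (hasSum_mul_prod (summable_thetaOdd hl x) (summable_thetaEven hl y)).mul_left (exp x)
  have h3 := (hasSum_mul_prod (summable_thetaEven hl x) (summable_thetaOdd hl y)).mul_left
    (-exp x)
  have h4 := (intProdParityEquiv.hasSum_iff).mpr h1
  refine h4.unique ?_
  rw [show exp x * (thetaOdd l x * thetaEven l y - thetaEven l x * thetaOdd l y) =
    exp x * (thetaOdd l x * thetaEven l y) + -exp x * (thetaEven l x * thetaOdd l y) by ring]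
  refine HasSum.sum ?_ ?_
  · refine Eq.subst (motive := fun f : ℤ × ℤ → ℂ => HasSum f _) (funext fun p => ?_) h2
    simp only [Function.comp, intProdParityEquiv, Equiv.coe_fn_mk, Sum.elim_inl, thetaTerm]
    rw [← exp_add, ← exp_add, ← exp_add, exp_eq_exp_iff_exists_int]
    -- With `k = p.1`, the signs contribute `(m+n)πi = (2k+2)πi`. In the odd case they contribute
    -- `(2k+1)πi`, of which one `πi` is matched by the explicit minus sign.
    refine ⟨-p.1 - 1, ?_⟩
    push_cast
    ring
  · refine Eq.subst (motive := fun f : ℤ × ℤ → ℂ => HasSum f _) (funext fun p => ?_) h3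
    simp only [Function.comp, intProdParityEquiv, Equiv.coe_fn_mk, Sum.elim_inr, thetaTerm]
    rw [← mul_neg_one (exp x), ← exp_pi_mul_I, ← exp_add, ← exp_add, ← exp_add, ← exp_add,
      exp_eq_exp_iff_exists_int]
    refine ⟨-p.1, ?_⟩
    push_cast
    ring

/-- The theta function in additive notation, normalized to be odd: `x^{-1/2} θ(x)`, `x = exp z`. -/
noncomputable def sigmaTheta (l z : ℂ) : ℂ := exp (-(z / 2)) * qTheta (exp l) (exp z)

theorem qTheta_exp (l z : ℂ) : qTheta (exp l) (exp z) = exp (z / 2) * sigmaTheta l z := by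
  rw [sigmaTheta, ← mul_assoc, ← exp_add, add_neg_cancel, exp_zero, one_mul]

/-- Split off the first factor: `θ(x) = (1 - x)(qx)_∞(q/x)_∞`. The infinite products are exchanged
by `x ↦ 1/x`, and `x^{-1/2}(1 - x)` is odd. -/
theorem sigmaTheta_neg {l : ℂ} (hl : l.re < 0) (z : ℂ) : sigmaTheta l (-z) = -sigmaTheta l z := by
  have hq := norm_exp_lt_one hl
  have h1 := qPoch_eq_one_sub_mul hq (exp z)
  have h2 := qPoch_eq_one_sub_mul hq (exp (-z))
  have e1 : exp l / exp (-z) = exp z * exp l := by rw [exp_neg]; field_simp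
  have e2 : exp l / exp z = exp (-z) * exp l := by rw [exp_neg]; field_simp
  have e3 : exp (-(-z / 2)) = exp z * exp (-(z / 2)) := by rw [← exp_add]; congr 1; ring
  have e4 : exp z * exp (-z) = 1 := by rw [← exp_add, add_neg_cancel, exp_zero]
  rw [sigmaTheta, sigmaTheta, qTheta, qTheta, e1, e2, e3, h1, h2]
  linear_combination (-exp (-(z / 2)) * qPoch (exp l) (exp (-z) * exp l) *
    qPoch (exp l) (exp z * exp l)) * e4

/-- The functions are the odd and even theta series divided by `(q)_∞`. The half-integral powers in
`σ` absorb exactly the prefactor `exp x` of the product formula. -/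
theorem exists_sigmaTheta_eq_det {l : ℂ} (hl : l.re < 0) : ∃ f g : ℂ → ℂ, ∀ x y,
    sigmaTheta l (x + y) * sigmaTheta l (x - y) = f x * g y - g x * f y := by
  have hQ := qPoch_self_ne_zero (norm_exp_lt_one hl)
  set Q := qPoch (exp l) (exp l) with hQdef
  refine ⟨fun x => Q⁻¹ * thetaOdd l x, fun x => Q⁻¹ * thetaEven l x, fun x y => ?_⟩
  have h := tsum_thetaTerm_mul_tsum_thetaTerm hl x y
  rw [← jacobi_tripleProduct hl, ← jacobi_tripleProduct hl, ← hQdef, qTheta_exp, qTheta_exp] at h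
  have e : exp ((x + y) / 2) * exp ((x - y) / 2) = exp x := by rw [← exp_add]; congr 1; ring
  have hx := exp_ne_zero x
  have hmul : Q ^ 2 * (sigmaTheta l (x + y) * sigmaTheta l (x - y)) =
      thetaOdd l x * thetaEven l y - thetaEven l x * thetaOdd l y := by
    apply mul_left_cancel₀ hx
    rw [← h, ← e]
    ring
  field_simp
  linear_combination hmul

/-- The **Weierstrass three-term identity** for the theta function. -/
theorem sigmaTheta_weierstrass {l : ℂ} (hl : l.re < 0) (x y z w : ℂ) :
    sigmaTheta l (x + y) * sigmaTheta l (x - y) * (sigmaTheta l (z + w) * sigmaTheta l (z - w)) +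
      sigmaTheta l (y + z) * sigmaTheta l (y - z) *
        (sigmaTheta l (x + w) * sigmaTheta l (x - w)) +
      sigmaTheta l (z + x) * sigmaTheta l (z - x) *
        (sigmaTheta l (y + w) * sigmaTheta l (y - w)) = 0 := by
  obtain ⟨f, g, h⟩ := exists_sigmaTheta_eq_det hl
  -- Each product is now a minor of the 2 × 4 matrix with columns `(f, g)` at `x, y, z, w`: this is
  -- the Plücker relation.
  simp only [h]
  ring

/-- A form of the Weierstrass relation suited to applications: one quadruple of arguments determines
the other two through half-sums, and the doubled hypotheses let these be supplied without fractions.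
-/
theorem sigmaTheta_three_term {l : ℂ} (hl : l.re < 0) {p₁ p₂ p₃ p₄ : ℂ}
    (r₁ r₂ r₃ r₄ t₁ t₂ t₃ t₄ : ℂ)
    (hr₁ : 2 * r₁ = p₁ - p₂ + p₃ + p₄) (hr₂ : 2 * r₂ = p₁ - p₂ - p₃ - p₄)
    (hr₃ : 2 * r₃ = p₁ + p₂ + p₃ - p₄) (hr₄ : 2 * r₄ = p₁ + p₂ - p₃ + p₄)
    (ht₁ : 2 * t₁ = p₁ + p₂ + p₃ + p₄) (ht₂ : 2 * t₂ = p₃ + p₄ - p₁ - p₂)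
    (ht₃ : 2 * t₃ = p₁ - p₂ + p₃ - p₄) (ht₄ : 2 * t₄ = p₁ - p₂ - p₃ + p₄) :
    sigmaTheta l p₁ * sigmaTheta l p₂ * sigmaTheta l p₃ * sigmaTheta l p₄ +
      sigmaTheta l r₁ * sigmaTheta l r₂ * sigmaTheta l r₃ * sigmaTheta l r₄ +
      sigmaTheta l t₁ * sigmaTheta l t₂ * sigmaTheta l t₃ * sigmaTheta l t₄ = 0 := by
  have h := sigmaTheta_weierstrass hl ((p₁ + p₂) / 2) ((p₁ - p₂) / 2) ((p₃ + p₄) / 2)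
    ((p₃ - p₄) / 2)
  rw [show (p₁ + p₂) / 2 + (p₁ - p₂) / 2 = p₁ by ring,
    show (p₁ + p₂) / 2 - (p₁ - p₂) / 2 = p₂ by ring,
    show (p₃ + p₄) / 2 + (p₃ - p₄) / 2 = p₃ by ring,
    show (p₃ + p₄) / 2 - (p₃ - p₄) / 2 = p₄ by ring,
    show (p₁ - p₂) / 2 + (p₃ + p₄) / 2 = r₁ by linear_combination -hr₁ / 2,
    show (p₁ - p₂) / 2 - (p₃ + p₄) / 2 = r₂ by linear_combination -hr₂ / 2,
    show (p₁ + p₂) / 2 + (p₃ - p₄) / 2 = r₃ by linear_combination -hr₃ / 2,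
    show (p₁ + p₂) / 2 - (p₃ - p₄) / 2 = r₄ by linear_combination -hr₄ / 2,
    show (p₃ + p₄) / 2 + (p₁ + p₂) / 2 = t₁ by linear_combination -ht₁ / 2,
    show (p₃ + p₄) / 2 - (p₁ + p₂) / 2 = t₂ by linear_combination -ht₂ / 2,
    show (p₁ - p₂) / 2 + (p₃ - p₄) / 2 = t₃ by linear_combination -ht₃ / 2,
    show (p₁ - p₂) / 2 - (p₃ - p₄) / 2 = t₄ by linear_combination -ht₄ / 2] at h
  linear_combination h

/-! ### Theta-function weights of the gauge-transformed matrices -/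

/-- The `q`-shifted factorial in additive notation, `(a)_∞` with `a = exp z`. -/
noncomputable def qPochExp (l z : ℂ) : ℂ := qPoch (exp l) (exp z)

theorem sigmaTheta_eq_qPochExp (l z : ℂ) :
    sigmaTheta l z = exp (-(z / 2)) * (qPochExp l z * qPochExp l (l - z)) := by
  rw [sigmaTheta, qTheta, qPochExp, qPochExp, exp_sub]

/-- The factor `b^{-1/2} (b)_∞` of `σ(b)`, in additive notation. -/
noncomputable def sigmaLeft (l b : ℂ) : ℂ := exp (-(b / 2)) * qPochExp l b

/-- The factor `(q/b)_∞` of `σ(b)`, in additive notation. -/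
noncomputable def sigmaRight (l b : ℂ) : ℂ := qPochExp l (l - b)

theorem sigmaLeft_mul_sigmaRight (l b : ℂ) : sigmaLeft l b * sigmaRight l b = sigmaTheta l b := by
  rw [sigmaLeft, sigmaRight, sigmaTheta_eq_qPochExp, mul_assoc]

/-- The entry `(r, r)` of the gauge-transformed matrix. -/
noncomputable def faceA (l b₀ b₁ d x ξ : ℂ) : ℂ :=
  sigmaLeft l b₀ * sigmaRight l b₁ * sigmaTheta l (d - b₁ + x) /
    (sigmaTheta l (d - b₁) * sigmaTheta l (x + b₀)) * exp ((d - b₀ - b₁) * ξ)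

/-- The entry `(r, r + 1)` of the gauge-transformed matrix. -/
noncomputable def faceB (l b₀ x ξ : ℂ) : ℂ :=
  sigmaTheta l x / sigmaTheta l (x + b₀) * exp (-b₀ * ξ)

/-- The entry `(r + 1, r)` of the gauge-transformed matrix. -/
noncomputable def faceC (l b₀ b₁ d x ξ : ℂ) : ℂ :=
  sigmaTheta l (d - b₀ - b₁) * sigmaTheta l d / (sigmaTheta l (d - b₀) * sigmaTheta l (d - b₁)) *
    (sigmaTheta l (x + b₀ - b₁) / sigmaTheta l (x + b₀)) * exp (-b₁ * ξ)

/-- The entry `(r + 1, r + 1)` of the gauge-transformed matrix. -/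
noncomputable def faceD (l b₀ b₁ d x ξ : ℂ) : ℂ :=
  sigmaRight l b₀ * sigmaLeft l b₁ * sigmaTheta l (d - b₀ - x) /
    (sigmaTheta l (d - b₀) * sigmaTheta l (x + b₀)) * exp (-d * ξ)

/-! ### The nine entries of the dynamical Yang–Baxter equation -/

theorem face_entry_zero_zero {l A B C d x y ξ η : ℂ} (hl : l.re < 0)
    (hxB : sigmaTheta l (x + B) ≠ 0)
    (hyA : sigmaTheta l (y + A) ≠ 0)
    (hxyA : sigmaTheta l (x + y + A) ≠ 0)
    (hC : sigmaTheta l (d - C) ≠ 0)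
    (hAC : sigmaTheta l (d - A - C) ≠ 0)
    (hBC : sigmaTheta l (d - B - C) ≠ 0) :
    faceA l B C (d - A) x ξ * faceA l A B (d - C) y η +
      faceB l B x ξ * faceA l A C d (x + y) (ξ + η) * faceC l A B (d - C) y η =
    faceA l A C (d - B) (x + y) (ξ + η) := by
  have W := sigmaTheta_three_term hl (p₁ := B) (p₂ := d - A - C + x) (p₃ := d - B - C + y)
    (p₄ := x + y + A) (y + A) (-(d - B - C + (x + y))) (d - A - C) (x + B)
    (d - C + (x + y)) (y + A - B) (-x) (-(d - A - B - C))
    (by ring) (by ring) (by ring) (by ring) (by ring) (by ring) (by ring) (by ring)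
  simp only [sigmaTheta_neg hl] at W
  unfold faceA faceB faceC
  simp only [sub_right_comm d C B, sub_right_comm d C A, sub_right_comm d B A,
    sub_right_comm (d - A) C B]
  simp only [sub_mul, mul_add, neg_mul, exp_sub, exp_add, exp_neg]
  have := exp_ne_zero (A * ξ); have := exp_ne_zero (A * η)
  have := exp_ne_zero (B * ξ); have := exp_ne_zero (B * η)
  have := exp_ne_zero (C * ξ); have := exp_ne_zero (C * η)
  have := exp_ne_zero (d * ξ); have := exp_ne_zero (d * η)
  -- Only the product of the two `faceA` on the left contains both halves of `σ(B)`; the left half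
  -- of `σ(A)` and the right half of `σ(C)` are common to all three terms. The other single-relation
  -- entries are arranged likewise.
  rw [← sigmaLeft_mul_sigmaRight l B] at W
  linear_combination (norm := (field_simp; ring))
    (sigmaLeft l A * sigmaRight l C * exp (d * ξ) * exp (d * η)) /
    (exp (A * ξ) * exp (A * η) * exp (B * ξ) * exp (B * η) * exp (C * ξ) * exp (C * η) *
      sigmaTheta l (x + B) * sigmaTheta l (y + A) * sigmaTheta l (x + y + A) * sigmaTheta l
        (d - A - C) * sigmaTheta l (d - B - C)) * W

theorem face_entry_zero_one {l A B C d x y ξ η : ℂ} (hl : l.re < 0)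
    (hxB : sigmaTheta l (x + B) ≠ 0)
    (hyA : sigmaTheta l (y + A) ≠ 0)
    (hxyA : sigmaTheta l (x + y + A) ≠ 0)
    (hC : sigmaTheta l (d - C) ≠ 0)
    (hAC : sigmaTheta l (d - A - C) ≠ 0) :
    faceA l B C (d - A) x ξ * faceB l A y η +
      faceB l B x ξ * faceA l A C d (x + y) (ξ + η) * faceD l A B (d - C) y η =
    faceB l A (x + y) (ξ + η) * faceA l B C d x ξ := by
  have W := sigmaTheta_three_term hl (p₁ := d - A - C + x) (p₂ := y) (p₃ := x + y + A)
    (p₄ := d - C) (d - C + x) (-(y + A)) (x + y) (d - A - C)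
    (d - C + (x + y)) A x (d - A - C - y)
    (by ring) (by ring) (by ring) (by ring) (by ring) (by ring) (by ring) (by ring)
  simp only [sigmaTheta_neg hl] at W
  unfold faceA faceB faceD
  simp only [sub_right_comm d C A]
  simp only [sub_mul, mul_add, neg_mul, neg_sub, exp_sub, exp_add, exp_neg]
  have := exp_ne_zero (A * ξ); have := exp_ne_zero (A * η)
  have := exp_ne_zero (B * ξ); have := exp_ne_zero (B * η)
  have := exp_ne_zero (C * ξ); have := exp_ne_zero (C * η)
  have := exp_ne_zero (d * ξ); have := exp_ne_zero (d * η)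
  rw [← sigmaLeft_mul_sigmaRight l A] at W
  linear_combination (norm := (field_simp; ring))
    (sigmaLeft l B * sigmaRight l C * exp (d * ξ)) /
    (exp (A * ξ) * exp (A * η) * exp (B * ξ) * exp (C * ξ) * sigmaTheta l (x + B) *
      sigmaTheta l (y + A) * sigmaTheta l (x + y + A) * sigmaTheta l (d - C) * sigmaTheta l
        (d - A - C)) * W

theorem face_entry_one_zero {l A B C d x y ξ η : ℂ} (hl : l.re < 0)
    (hxB : sigmaTheta l (x + B) ≠ 0)
    (hyA : sigmaTheta l (y + A) ≠ 0)
    (hxyA : sigmaTheta l (x + y + A) ≠ 0)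
    (hB : sigmaTheta l (d - B) ≠ 0)
    (hC : sigmaTheta l (d - C) ≠ 0)
    (hAB : sigmaTheta l (d - A - B) ≠ 0)
    (hAC : sigmaTheta l (d - A - C) ≠ 0)
    (hBC : sigmaTheta l (d - B - C) ≠ 0) :
    faceC l B C (d - A) x ξ * faceA l A B (d - C) y η +
      faceD l B C (d - A) x ξ * faceA l A C d (x + y) (ξ + η) * faceC l A B (d - C) y η =
    faceA l A B d y η * faceC l A C (d - B) (x + y) (ξ + η) := by
  have W := sigmaTheta_three_term hl (p₁ := d - A) (p₂ := x + B - C) (p₃ := d - B - C + y)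
    (p₄ := x + y + A) (d - B + y) (-(x + y + A - C)) (d - A - C) (x + B)
    (d - C + (x + y)) (y + A - B) (d - A - B - x) C
    (by ring) (by ring) (by ring) (by ring) (by ring) (by ring) (by ring) (by ring)
  simp only [sigmaTheta_neg hl] at W
  unfold faceA faceC faceD
  simp only [sub_right_comm d C B, sub_right_comm d C A, sub_right_comm d B A,
    sub_right_comm (d - A) C B]
  simp only [sub_mul, mul_add, neg_mul, neg_sub, exp_sub, exp_add, exp_neg]
  have := exp_ne_zero (A * ξ); have := exp_ne_zero (A * η)
  have := exp_ne_zero (B * ξ); have := exp_ne_zero (B * η)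
  have := exp_ne_zero (C * ξ); have := exp_ne_zero (C * η)
  have := exp_ne_zero (d * ξ); have := exp_ne_zero (d * η)
  rw [← sigmaLeft_mul_sigmaRight l C] at W
  linear_combination (norm := (field_simp; ring))
    (sigmaLeft l A * sigmaRight l B * sigmaTheta l (d - A - B - C) * exp (d * η)) /
    (exp (A * η) * exp (B * η) * exp (C * ξ) * exp (C * η) * sigmaTheta l (x + B) *
      sigmaTheta l (y + A) * sigmaTheta l (x + y + A) * sigmaTheta l (d - A - B) * sigmaTheta l
        (d - A - C) * sigmaTheta l (d - B - C)) * W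

theorem face_entry_one_two {l A B C d x y ξ η : ℂ} (hl : l.re < 0)
    (hxB : sigmaTheta l (x + B) ≠ 0)
    (hyA : sigmaTheta l (y + A) ≠ 0)
    (hxyA : sigmaTheta l (x + y + A) ≠ 0)
    (hB : sigmaTheta l (d - B) ≠ 0)
    (hAB : sigmaTheta l (d - A - B) ≠ 0) :
    faceD l B C (d - A) x ξ * faceB l A (x + y) (ξ + η) =
    faceA l A B d y η * faceD l A C (d - B) (x + y) (ξ + η) * faceB l B x ξ +
      faceB l A y η * faceD l B C d x ξ := by
  have W := sigmaTheta_three_term hl (p₁ := A) (p₂ := d - B + y) (p₃ := d - A - B - (x + y))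
    (p₄ := x) (-y) (-(d - A - B)) (d - B - x) (x + y + A)
    (d - B) (-(y + A)) (-(x + y)) (-(d - A - B - x))
    (by ring) (by ring) (by ring) (by ring) (by ring) (by ring) (by ring) (by ring)
  simp only [sigmaTheta_neg hl] at W
  unfold faceA faceB faceD
  simp only [sub_right_comm d B A]
  simp only [sub_mul, mul_add, neg_mul, neg_sub, exp_sub, exp_add, exp_neg]
  have := exp_ne_zero (A * ξ); have := exp_ne_zero (A * η)
  have := exp_ne_zero (B * ξ); have := exp_ne_zero (B * η)
  have := exp_ne_zero (C * ξ); have := exp_ne_zero (C * η)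
  have := exp_ne_zero (d * ξ); have := exp_ne_zero (d * η)
  rw [← sigmaLeft_mul_sigmaRight l A] at W
  linear_combination (norm := (field_simp; ring))
    -(sigmaRight l B * sigmaLeft l C) /
    (exp (d * ξ) * exp (A * η) * sigmaTheta l (x + B) * sigmaTheta l (y + A) *
      sigmaTheta l (x + y + A) * sigmaTheta l (d - A - B) * sigmaTheta l (d - B)) * W

theorem face_entry_two_one {l A B C d x y ξ η : ℂ} (hl : l.re < 0)
    (hxB : sigmaTheta l (x + B) ≠ 0)
    (hyA : sigmaTheta l (y + A) ≠ 0)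
    (hxyA : sigmaTheta l (x + y + A) ≠ 0)
    (hA : sigmaTheta l (d - A) ≠ 0)
    (hB : sigmaTheta l (d - B) ≠ 0)
    (hC : sigmaTheta l (d - C) ≠ 0)
    (hAB : sigmaTheta l (d - A - B) ≠ 0)
    (hAC : sigmaTheta l (d - A - C) ≠ 0) :
    faceC l A C d (x + y) (ξ + η) * faceD l A B (d - C) y η =
    faceC l A B d y η * faceD l A C (d - B) (x + y) (ξ + η) * faceA l B C d x ξ +
      faceD l A B d y η * faceC l B C d x ξ := by
  have W := sigmaTheta_three_term hl (p₁ := y + A - B) (p₂ := C) (p₃ := d - A - B - (x + y))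
    (p₄ := d - C + x) (d - B - C) (-(d - A - y)) (-(x + B - C)) (x + y + A)
    (d - B) (d - A - C - y) (-(x + B)) (x + y + A - C)
    (by ring) (by ring) (by ring) (by ring) (by ring) (by ring) (by ring) (by ring)
  simp only [sigmaTheta_neg hl] at W
  unfold faceA faceC faceD
  simp only [sub_right_comm d C A, sub_right_comm d B A]
  simp only [sub_mul, mul_add, neg_mul, neg_sub, exp_sub, exp_add, exp_neg]
  have := exp_ne_zero (A * ξ); have := exp_ne_zero (A * η)
  have := exp_ne_zero (B * ξ); have := exp_ne_zero (B * η)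
  have := exp_ne_zero (C * ξ); have := exp_ne_zero (C * η)
  have := exp_ne_zero (d * ξ); have := exp_ne_zero (d * η)
  rw [← sigmaLeft_mul_sigmaRight l C] at W
  linear_combination (norm := (field_simp; ring))
    -(sigmaRight l A * sigmaLeft l B * sigmaTheta l d) /
    (exp (d * η) * exp (C * ξ) * sigmaTheta l (x + B) * sigmaTheta l (y + A) *
      sigmaTheta l (x + y + A) * sigmaTheta l (d - A) * sigmaTheta l (d - B) * sigmaTheta l
        (d - C)) * W

theorem face_entry_two_two {l A B C d x y ξ η : ℂ} (hl : l.re < 0)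
    (hxB : sigmaTheta l (x + B) ≠ 0)
    (hyA : sigmaTheta l (y + A) ≠ 0)
    (hxyA : sigmaTheta l (x + y + A) ≠ 0)
    (hA : sigmaTheta l (d - A) ≠ 0)
    (hB : sigmaTheta l (d - B) ≠ 0)
    (hAB : sigmaTheta l (d - A - B) ≠ 0) :
    faceD l A C d (x + y) (ξ + η) =
    faceC l A B d y η * faceD l A C (d - B) (x + y) (ξ + η) * faceB l B x ξ +
      faceD l A B d y η * faceD l B C d x ξ := by
  have W := sigmaTheta_three_term hl (p₁ := d) (p₂ := y + A - B) (p₃ := d - A - B - (x + y))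
    (p₄ := x) (d - A - y) B (d - B - x) (x + y + A)
    (d - B) (-(y + A)) (d - A - (x + y)) (x + B)
    (by ring) (by ring) (by ring) (by ring) (by ring) (by ring) (by ring) (by ring)
  simp only [sigmaTheta_neg hl] at W
  unfold faceB faceC faceD
  simp only [sub_right_comm d B A]
  simp only [sub_mul, mul_add, neg_mul, neg_sub, exp_sub, exp_add, exp_neg]
  have := exp_ne_zero (A * ξ); have := exp_ne_zero (A * η)
  have := exp_ne_zero (B * ξ); have := exp_ne_zero (B * η)
  have := exp_ne_zero (C * ξ); have := exp_ne_zero (C * η)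
  have := exp_ne_zero (d * ξ); have := exp_ne_zero (d * η)
  rw [← sigmaLeft_mul_sigmaRight l B] at W
  linear_combination (norm := (field_simp; ring))
    -(sigmaRight l A * sigmaLeft l C) /
    (exp (d * ξ) * exp (d * η) * sigmaTheta l (x + B) * sigmaTheta l (y + A) *
      sigmaTheta l (x + y + A) * sigmaTheta l (d - A) * sigmaTheta l (d - B)) * W

/-- The only entry with four terms, hence the only one that needs two Weierstrass relations. -/
theorem face_entry_one_one {l A B C d x y ξ η : ℂ} (hl : l.re < 0)
    (hxB : sigmaTheta l (x + B) ≠ 0)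
    (hyA : sigmaTheta l (y + A) ≠ 0)
    (hxyA : sigmaTheta l (x + y + A) ≠ 0)
    (hB : sigmaTheta l (d - B) ≠ 0)
    (hC : sigmaTheta l (d - C) ≠ 0)
    (hAB : sigmaTheta l (d - A - B) ≠ 0)
    (hAC : sigmaTheta l (d - A - C) ≠ 0) :
    faceC l B C (d - A) x ξ * faceB l A y η +
      faceD l B C (d - A) x ξ * faceA l A C d (x + y) (ξ + η) * faceD l A B (d - C) y η =
    faceA l A B d y η * faceD l A C (d - B) (x + y) (ξ + η) * faceA l B C d x ξ +
      faceB l A y η * faceC l B C d x ξ := by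
  -- This relation, free of `x` and `y`, turns the difference of the two `faceC * faceB` terms into
  -- a product containing `σ(2d - A - B - C)`. That product cancels against the matching one in
  -- `W2`.
  have W := sigmaTheta_three_term hl (p₁ := d - A - B - C) (p₂ := d - A) (p₃ := d - B)
    (p₄ := d - C) (d - B - C) (-d) (d - A - B) (d - A - C)
    (2 * d - A - B - C) A (-B) (-C)
    (by ring) (by ring) (by ring) (by ring) (by ring) (by ring) (by ring) (by ring)
  simp only [sigmaTheta_neg hl] at W
  have W2 := sigmaTheta_three_term hl (p₁ := d - A - B - x) (p₂ := d - C + (x + y))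
    (p₃ := d - A - C - y)
    (p₄ := d - B) (d - A - B - (x + y)) (-(d - C + x)) (d - A - C) (d - B + y)
    (2 * d - A - B - C) (-y) (-(x + y + A)) (-(x + B - C))
    (by ring) (by ring) (by ring) (by ring) (by ring) (by ring) (by ring) (by ring)
  simp only [sigmaTheta_neg hl] at W2
  unfold faceA faceB faceC faceD
  simp only [sub_right_comm d C A, sub_right_comm d B A]
  simp only [sub_mul, mul_add, neg_mul, neg_sub, exp_sub, exp_add, exp_neg]
  have := exp_ne_zero (A * ξ); have := exp_ne_zero (A * η)
  have := exp_ne_zero (B * ξ); have := exp_ne_zero (B * η)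
  have := exp_ne_zero (C * ξ); have := exp_ne_zero (C * η)
  have := exp_ne_zero (d * ξ); have := exp_ne_zero (d * η)
  rw [← sigmaLeft_mul_sigmaRight l A, ← sigmaLeft_mul_sigmaRight l B,
    ← sigmaLeft_mul_sigmaRight l C] at W
  linear_combination (norm := (field_simp; ring))
    (sigmaTheta l (x + B - C) * sigmaTheta l y * sigmaTheta l (x + y + A)) /
    (exp (C * ξ) * exp (A * η) * sigmaTheta l (x + B) * sigmaTheta l (y + A) *
      sigmaTheta l (x + y + A) * sigmaTheta l (d - A - B) * sigmaTheta l (d - A - C) *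
        sigmaTheta l (d - B) * sigmaTheta l (d - C)) * W +
    (sigmaLeft l A * sigmaLeft l B * sigmaLeft l C * sigmaRight l A * sigmaRight l B *
      sigmaRight l C) /
    (exp (C * ξ) * exp (A * η) * sigmaTheta l (x + B) * sigmaTheta l (y + A) *
      sigmaTheta l (x + y + A) * sigmaTheta l (d - A - B) * sigmaTheta l (d - A - C) *
        sigmaTheta l (d - B) * sigmaTheta l (d - C)) * W2

theorem face_entry_zero_two (l A B x y ξ η : ℂ) :
    faceB l B x ξ * faceB l A (x + y) (ξ + η) = faceB l A (x + y) (ξ + η) * faceB l B x ξ :=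
  mul_comm _ _

/-- No theta relation enters: the `d`-dependent ratios telescope to the same quotient on both sides.
-/
theorem face_entry_two_zero {l A B C d x y ξ η : ℂ}
    (hB : sigmaTheta l (d - B) ≠ 0) (hC : sigmaTheta l (d - C) ≠ 0)
    (hAB : sigmaTheta l (d - A - B) ≠ 0) (hAC : sigmaTheta l (d - A - C) ≠ 0) :
    faceC l A C d (x + y) (ξ + η) * faceC l A B (d - C) y η =
    faceC l A B d y η * faceC l A C (d - B) (x + y) (ξ + η) := by
  unfold faceC
  rw [sub_right_comm d C B, sub_right_comm d C A, sub_right_comm d B A, sub_right_comm (d - A) C B]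
  simp only [mul_add, neg_mul, exp_add, exp_neg]
  field_simp

/-! ### Genericity and the gauge factors -/

/-- The number `exp t` is not an integral power of `q = exp l`. -/
def QGeneric (l t : ℂ) : Prop := ∀ n : ℤ, exp t ≠ exp l ^ n

theorem QGeneric.neg {l t : ℂ} (h : QGeneric l t) : QGeneric l (-t) := by
  intro n hn
  refine h (-n) ?_
  rw [zpow_neg, ← hn, exp_neg, inv_inv]

theorem QGeneric.sub_self {l t : ℂ} (h : QGeneric l t) : QGeneric l (l - t) := by
  intro n hn
  refine h (1 - n) ?_
  rw [zpow_sub₀ (exp_ne_zero l), ← hn, zpow_one, ← exp_sub, sub_sub_cancel]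

theorem QGeneric.qPochExp_ne_zero {l t : ℂ} (hl : l.re < 0) (h : QGeneric l t) :
    qPochExp l t ≠ 0 := by
  refine qPoch_ne_zero (norm_exp_lt_one hl) fun k hk => h (-k) ?_
  rw [zpow_neg, zpow_natCast]
  exact eq_inv_of_mul_eq_one_left hk

theorem QGeneric.sigmaTheta_ne_zero {l t : ℂ} (hl : l.re < 0) (h : QGeneric l t) :
    sigmaTheta l t ≠ 0 := by
  rw [sigmaTheta_eq_qPochExp]
  exact mul_ne_zero (exp_ne_zero _)
    (mul_ne_zero (h.qPochExp_ne_zero hl) (h.sub_self.qPochExp_ne_zero hl))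

/-- The diagonal gauge factor attached to a parameter `b` and the dynamical parameter `t`. -/
noncomputable def gaugeFactor (l b t : ℂ) : ℂ :=
  qPochExp l (l - t) / qPochExp l (b - t) * exp ((b - t) / 2)

theorem gaugeFactor_ne_zero {l b t : ℂ} (hl : l.re < 0) (h : QGeneric l t)
    (h' : QGeneric l (t - b)) : gaugeFactor l b t ≠ 0 := by
  have h'' := h'.neg
  rw [neg_sub] at h''
  exact mul_ne_zero (div_ne_zero (h.sub_self.qPochExp_ne_zero hl) (h''.qPochExp_ne_zero hl))
    (exp_ne_zero _)

/-- The two gauge factors share the denominator `qPochExp l (-(d - b₀ - b₁))`. Their quotient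
therefore only replaces one half of `σ(d - b₁)` by the corresponding half attached to `d - b₀`. -/
theorem gauge_faceA {l b₀ b₁ d x : ℂ} (ξ : ℂ) (hl : l.re < 0)
    (hd₀ : QGeneric l (d - b₀)) (hd₁ : QGeneric l (d - b₁)) (hd₀₁ : QGeneric l (d - b₀ - b₁))
      (hx : sigmaTheta l (x + b₀) ≠ 0) :
    qPochExp l (l - b₁) * qPochExp l b₀ / (qPochExp l (l - (d - b₀)) * qPochExp l (d - b₁)) *
        (qTheta (exp l) (exp (d - b₁ + x)) / qTheta (exp l) (exp (x + b₀))) *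
        exp ((d - b₀ - b₁) * ξ) =
      (gaugeFactor l b₁ (d - b₀))⁻¹ * faceA l b₀ b₁ d x ξ * gaugeFactor l b₀ (d - b₁) := by
  have n1 := hd₀.sub_self.qPochExp_ne_zero hl
  have n2 := hd₁.qPochExp_ne_zero hl
  have n3 := hd₁.sub_self.qPochExp_ne_zero hl
  have n4 := hd₀₁.neg.qPochExp_ne_zero hl
  rw [qTheta_exp, qTheta_exp, faceA, gaugeFactor, gaugeFactor, sigmaLeft, sigmaRight,
    sigmaTheta_eq_qPochExp l (d - b₁), show b₁ - (d - b₀) = -(d - b₀ - b₁) by ring,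
    show b₀ - (d - b₁) = -(d - b₀ - b₁) by ring]
  generalize exp ((d - b₀ - b₁) * ξ) = E
  generalize qPochExp l (l - (d - b₀)) = P₁ at *
  generalize qPochExp l (d - b₁) = P₂ at *
  generalize qPochExp l (l - (d - b₁)) = P₃ at *
  generalize qPochExp l (-(d - b₀ - b₁)) = P₄ at *
  generalize sigmaTheta l (x + b₀) = P₅ at *
  generalize sigmaTheta l (d - b₁ + x) = P₆ at *
  simp only [add_div, sub_div, neg_sub, exp_add, exp_sub, exp_neg]
  field_simp

/-- Here the gauge supplies the whole constant: `faceB` has no dependence on `d`. -/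
theorem gauge_faceB {l b₀ b₁ d x : ℂ} (ξ : ℂ) (hl : l.re < 0) (hd : QGeneric l d)
    (hd₀ : QGeneric l (d - b₀)) (hd₁ : QGeneric l (d - b₁)) (hd₀₁ : QGeneric l (d - b₀ - b₁))
    (hx : sigmaTheta l (x + b₀) ≠ 0) :
    qPochExp l (l - d) * qPochExp l (-(d - b₀ - b₁)) /
          (qPochExp l (l - (d - b₀)) * qPochExp l (-(d - b₁))) *
        (qTheta (exp l) (exp x) / qTheta (exp l) (exp (x + b₀))) * exp (-b₀ * ξ) =
      (gaugeFactor l b₁ (d - b₀))⁻¹ * faceB l b₀ x ξ * gaugeFactor l b₁ d := by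
  have n1 := hd₀.sub_self.qPochExp_ne_zero hl
  have n2 := hd₁.neg.qPochExp_ne_zero hl
  have n3 := hd.sub_self.qPochExp_ne_zero hl
  have n4 := hd₀₁.neg.qPochExp_ne_zero hl
  rw [qTheta_exp, qTheta_exp, faceB, gaugeFactor, gaugeFactor,
    show b₁ - (d - b₀) = -(d - b₀ - b₁) by ring, show b₁ - d = -(d - b₁) by ring]
  generalize exp (-b₀ * ξ) = E
  generalize qPochExp l (l - (d - b₀)) = P₁ at *
  generalize qPochExp l (-(d - b₁)) = P₂ at *
  generalize qPochExp l (l - d) = P₃ at *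
  generalize qPochExp l (-(d - b₀ - b₁)) = P₄ at *
  generalize sigmaTheta l (x + b₀) = P₅ at *
  generalize sigmaTheta l x = P₆ at *
  simp only [add_div, sub_div, neg_sub, exp_add, exp_sub]
  field_simp

theorem gauge_faceC {l b₀ b₁ d x : ℂ} (ξ : ℂ) (hl : l.re < 0) (hd : QGeneric l d)
    (hd₀ : QGeneric l (d - b₀)) (hd₁ : QGeneric l (d - b₁)) (hd₀₁ : QGeneric l (d - b₀ - b₁))
    (hx : sigmaTheta l (x + b₀) ≠ 0) :
    qPochExp l (l - -(d - b₀ - b₁)) * qPochExp l d /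
          (qPochExp l (l - -(d - b₀)) * qPochExp l (d - b₁)) *
        (qTheta (exp l) (exp (x + b₀ - b₁)) / qTheta (exp l) (exp (x + b₀))) * exp (-b₁ * ξ) =
      (gaugeFactor l b₀ d)⁻¹ * faceC l b₀ b₁ d x ξ * gaugeFactor l b₀ (d - b₁) := by
  have n1 := hd₀.neg.sub_self.qPochExp_ne_zero hl
  have n1' := hd₀.neg.qPochExp_ne_zero hl
  have n2 := hd₁.qPochExp_ne_zero hl
  have n2' := hd₁.sub_self.qPochExp_ne_zero hl
  have n3 := hd.sub_self.qPochExp_ne_zero hl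
  have n4 := hd₀₁.neg.qPochExp_ne_zero hl
  -- The infinite products of this entry have arguments of the opposite sign; the two minus signs
  -- cancel in the quotient.
  have e1 : sigmaTheta l (d - b₀ - b₁) = -sigmaTheta l (-(d - b₀ - b₁)) := by
    rw [sigmaTheta_neg hl, neg_neg]
  have e2 : sigmaTheta l (d - b₀) = -sigmaTheta l (-(d - b₀)) := by
    rw [sigmaTheta_neg hl, neg_neg]
  rw [qTheta_exp, qTheta_exp, faceC, gaugeFactor, gaugeFactor, e1, e2,
    sigmaTheta_eq_qPochExp l (d - b₁), sigmaTheta_eq_qPochExp l d,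
    sigmaTheta_eq_qPochExp l (-(d - b₀)), sigmaTheta_eq_qPochExp l (-(d - b₀ - b₁)),
    show b₀ - (d - b₁) = -(d - b₀ - b₁) by ring, show b₀ - d = -(d - b₀) by ring]
  generalize exp (-b₁ * ξ) = E
  generalize qPochExp l (l - -(d - b₀)) = P₁ at *
  generalize qPochExp l (d - b₁) = P₂ at *
  generalize qPochExp l (l - (d - b₁)) = P₇ at *
  generalize qPochExp l (-(d - b₀)) = P₈ at *
  generalize qPochExp l (l - d) = P₃ at *
  generalize qPochExp l (-(d - b₀ - b₁)) = P₄ at *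
  generalize qPochExp l (l - -(d - b₀ - b₁)) = P₉ at *
  generalize qPochExp l d = P₁₀ at *
  generalize sigmaTheta l (x + b₀) = P₅ at *
  generalize sigmaTheta l (x + b₀ - b₁) = P₆ at *
  simp only [add_div, sub_div, neg_sub, exp_add, exp_sub, exp_neg]
  field_simp

theorem gauge_faceD {l b₀ b₁ d x : ℂ} (ξ : ℂ) (hl : l.re < 0) (hd : QGeneric l d)
    (hd₀ : QGeneric l (d - b₀)) (hd₁ : QGeneric l (d - b₁)) (hx : sigmaTheta l (x + b₀) ≠ 0) :
    qPochExp l (l - b₀) * qPochExp l b₁ / (qPochExp l (l - -(d - b₀)) * qPochExp l (-(d - b₁))) *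
        (qTheta (exp l) (exp (-(d - b₀ - x))) / qTheta (exp l) (exp (x + b₀))) *
        exp (-d * ξ) =
      (gaugeFactor l b₀ d)⁻¹ * faceD l b₀ b₁ d x ξ * gaugeFactor l b₁ d := by
  have n1 := hd₀.neg.sub_self.qPochExp_ne_zero hl
  have n1' := hd₀.neg.qPochExp_ne_zero hl
  have n2 := hd₁.neg.qPochExp_ne_zero hl
  have n3 := hd.sub_self.qPochExp_ne_zero hl
  have e2 : sigmaTheta l (d - b₀) = -sigmaTheta l (-(d - b₀)) := by
    rw [sigmaTheta_neg hl, neg_neg]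
  rw [qTheta_exp, qTheta_exp, faceD, gaugeFactor, gaugeFactor, sigmaLeft, sigmaRight, e2,
    sigmaTheta_neg hl (d - b₀ - x),
    sigmaTheta_eq_qPochExp l (-(d - b₀)),
    show b₁ - d = -(d - b₁) by ring, show b₀ - d = -(d - b₀) by ring]
  generalize exp (-d * ξ) = E
  generalize qPochExp l (l - -(d - b₀)) = P₁ at *
  generalize qPochExp l (-(d - b₁)) = P₂ at *
  generalize qPochExp l (-(d - b₀)) = P₈ at *
  generalize qPochExp l (l - d) = P₃ at *
  generalize sigmaTheta l (x + b₀) = P₅ at *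
  generalize sigmaTheta l (d - b₀ - x) = P₆ at *
  simp only [add_div, sub_div, neg_sub, exp_add, exp_sub, exp_neg]
  field_simp

/-! ### The 3 × 3 equation and its diagonal gauge -/

/-- A `3 × 3` matrix with a `2 × 2` block in the first two rows and columns. -/
def upperBlock (a b c d : ℂ) : Matrix (Fin 3) (Fin 3) ℂ := !![a, b, 0; c, d, 0; 0, 0, 1]

/-- A `3 × 3` matrix with a `2 × 2` block in the last two rows and columns. -/
def lowerBlock (a b c d : ℂ) : Matrix (Fin 3) (Fin 3) ℂ := !![1, 0, 0; 0, a, b; 0, c, d]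

/-- The gauge-transformed matrix acting on the first two positions. -/
noncomputable def faceUpper (l b₀ b₁ d x ξ : ℂ) : Matrix (Fin 3) (Fin 3) ℂ :=
  upperBlock (faceA l b₀ b₁ d x ξ) (faceB l b₀ x ξ) (faceC l b₀ b₁ d x ξ) (faceD l b₀ b₁ d x ξ)

/-- The gauge-transformed matrix acting on the last two positions. -/
noncomputable def faceLower (l b₀ b₁ d x ξ : ℂ) : Matrix (Fin 3) (Fin 3) ℂ :=
  lowerBlock (faceA l b₀ b₁ d x ξ) (faceB l b₀ x ξ) (faceC l b₀ b₁ d x ξ) (faceD l b₀ b₁ d x ξ)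

/-- The dynamical Yang–Baxter equation for the gauge-transformed matrices. -/
theorem face_yangBaxter {l A B C d x y : ℂ} (ξ η : ℂ) (hl : l.re < 0)
    (hxB : sigmaTheta l (x + B) ≠ 0) (hyA : sigmaTheta l (y + A) ≠ 0)
    (hxyA : sigmaTheta l (x + y + A) ≠ 0) (hA : sigmaTheta l (d - A) ≠ 0)
    (hB : sigmaTheta l (d - B) ≠ 0) (hC : sigmaTheta l (d - C) ≠ 0)
    (hAB : sigmaTheta l (d - A - B) ≠ 0) (hAC : sigmaTheta l (d - A - C) ≠ 0)
    (hBC : sigmaTheta l (d - B - C) ≠ 0) :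
    faceUpper l B C (d - A) x ξ * faceLower l A C d (x + y) (ξ + η) *
        faceUpper l A B (d - C) y η =
      faceLower l A B d y η * faceUpper l A C (d - B) (x + y) (ξ + η) *
        faceLower l B C d x ξ := by
  have h00 := face_entry_zero_zero (ξ := ξ) (η := η) hl hxB hyA hxyA hC hAC hBC
  have h01 := face_entry_zero_one (B := B) (ξ := ξ) (η := η) hl hxB hyA hxyA hC hAC
  have h02 := face_entry_zero_two l A B x y ξ η
  have h10 := face_entry_one_zero (ξ := ξ) (η := η) hl hxB hyA hxyA hB hC hAB hAC hBC
  have h11 := face_entry_one_one (ξ := ξ) (η := η) hl hxB hyA hxyA hB hC hAB hAC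
  have h12 := face_entry_one_two (C := C) (ξ := ξ) (η := η) hl hxB hyA hxyA hB hAB
  have h20 := face_entry_two_zero (x := x) (y := y) (ξ := ξ) (η := η) hB hC hAB hAC
  have h21 := face_entry_two_one (ξ := ξ) (η := η) hl hxB hyA hxyA hA hB hC hAB hAC
  have h22 := face_entry_two_two (C := C) (ξ := ξ) (η := η) hl hxB hyA hxyA hA hB hAB
  simp only [faceUpper, faceLower]
  generalize faceA l B C (d - A) x ξ = a₁ at *
  generalize faceB l B x ξ = b₁ at *
  generalize faceC l B C (d - A) x ξ = c₁ at *
  generalize faceD l B C (d - A) x ξ = d₁ at *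
  generalize faceA l A C d (x + y) (ξ + η) = a₂ at *
  generalize faceB l A (x + y) (ξ + η) = b₂ at *
  generalize faceC l A C d (x + y) (ξ + η) = c₂ at *
  generalize faceD l A C d (x + y) (ξ + η) = d₂ at *
  generalize faceA l A B (d - C) y η = a₃ at *
  generalize faceB l A y η = b₃ at *
  generalize faceC l A B (d - C) y η = c₃ at *
  generalize faceD l A B (d - C) y η = d₃ at *
  generalize faceA l A B d y η = a₄ at *
  generalize faceC l A B d y η = c₄ at *
  generalize faceD l A B d y η = d₄ at *
  generalize faceA l A C (d - B) (x + y) (ξ + η) = a₅ at *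
  generalize faceC l A C (d - B) (x + y) (ξ + η) = c₅ at *
  generalize faceD l A C (d - B) (x + y) (ξ + η) = d₅ at *
  generalize faceA l B C d x ξ = a₆ at *
  generalize faceC l B C d x ξ = c₆ at *
  generalize faceD l B C d x ξ = d₆ at *
  ext i j
  fin_cases i <;> fin_cases j <;>
    simp [upperBlock, lowerBlock, Matrix.mul_apply, Fin.sum_univ_three]
  · linear_combination h00
  · linear_combination h01
  · linear_combination h02
  · linear_combination h10
  · linear_combination h11
  · linear_combination h12
  · linear_combination h20
  · linear_combination h21
  · linear_combination h22

/-- Conjugation of a matrix by two diagonal matrices, `diag(h)⁻¹ F diag(g)`. -/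
noncomputable def gaugeTransform {n : Type*} (h g : n → ℂ) (F : Matrix n n ℂ) : Matrix n n ℂ :=
  Matrix.of fun i j => (h i)⁻¹ * F i j * g j

/-- The inner factors `g` and `g⁻¹` cancel, so gauges telescope along a product. -/
theorem gaugeTransform_mul {n : Type*} [Fintype n] {h g k : n → ℂ} (hg : ∀ i, g i ≠ 0)
    (F F' : Matrix n n ℂ) :
    gaugeTransform h g F * gaugeTransform g k F' = gaugeTransform h k (F * F') := by
  ext i j
  simp only [gaugeTransform, Matrix.mul_apply, Matrix.of_apply, Finset.mul_sum, Finset.sum_mul]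
  refine Finset.sum_congr rfl fun m _ => ?_
  have := hg m
  field_simp

/-- The gauge factors of three consecutive positions. -/
noncomputable def gaugeVec (l d b₀ b₁ b₂ : ℂ) : Fin 3 → ℂ :=
  ![gaugeFactor l b₀ (d - b₂ - b₁), gaugeFactor l b₁ (d - b₂), gaugeFactor l b₂ d]

/-- The idle position must carry the same nonzero gauge on both sides, so that its diagonal entry
stays `1`. -/
theorem upperBlock_gauge {g₀ g₁ h₀ h₁ k : ℂ} (hk : k ≠ 0) (a b c d : ℂ) :
    upperBlock (h₀⁻¹ * a * g₀) (h₀⁻¹ * b * g₁) (h₁⁻¹ * c * g₀) (h₁⁻¹ * d * g₁) =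
      gaugeTransform ![h₀, h₁, k] ![g₀, g₁, k] (upperBlock a b c d) := by
  ext i j
  fin_cases i <;> fin_cases j <;> simp [upperBlock, gaugeTransform, hk]

theorem lowerBlock_gauge {g₀ g₁ h₀ h₁ k : ℂ} (hk : k ≠ 0) (a b c d : ℂ) :
    lowerBlock (h₀⁻¹ * a * g₀) (h₀⁻¹ * b * g₁) (h₁⁻¹ * c * g₀) (h₁⁻¹ * d * g₁) =
      gaugeTransform ![k, h₀, h₁] ![k, g₀, g₁] (lowerBlock a b c d) := by
  ext i j
  fin_cases i <;> fin_cases j <;> simp [lowerBlock, gaugeTransform, hk]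

/-! ### From three positions to `M` -/

/-- The extension of a matrix by the identity along an injection of index sets. -/
def embedBlock {m n : Type*} [Fintype m] [DecidableEq m] [Fintype n] [DecidableEq n] (f : m → n)
    (F : Matrix m m ℂ) : Matrix n n ℂ :=
  1 + (1 : Matrix n n ℂ).submatrix id f * (F - 1) * (1 : Matrix n n ℂ).submatrix f id

/-- Injectivity of `f` gives `J' * J = 1` for the inclusion `J` and its transpose `J'`, which makes
`F ↦ 1 + J (F - 1) J'` multiplicative. -/
theorem embedBlock_mul {m n : Type*} [Fintype m] [DecidableEq m] [Fintype n] [DecidableEq n]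
    {f : m → n} (hf : Function.Injective f) (F F' : Matrix m m ℂ) :
    embedBlock f F * embedBlock f F' = embedBlock f (F * F') := by
  have h : (1 : Matrix n n ℂ).submatrix f id * (1 : Matrix n n ℂ).submatrix id f = 1 := by
    rw [← Matrix.submatrix_mul _ _ _ _ _ Function.bijective_id, one_mul,
      Matrix.submatrix_one f hf]
  unfold embedBlock
  generalize (1 : Matrix n n ℂ).submatrix f id = J' at *
  generalize (1 : Matrix n n ℂ).submatrix id f = J at *
  have e : J * (F - 1) * J' * (J * (F' - 1) * J') = J * ((F - 1) * (F' - 1)) * J' := by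
    calc J * (F - 1) * J' * (J * (F' - 1) * J') = J * (F - 1) * (J' * J) * (F' - 1) * J' := by
          simp only [Matrix.mul_assoc]
      _ = _ := by rw [h, Matrix.mul_one, Matrix.mul_assoc J]
  have e' : F * F' - 1 = (F - 1) + (F' - 1) + (F - 1) * (F' - 1) := by noncomm_ring
  rw [e', Matrix.add_mul, Matrix.mul_add, Matrix.mul_add, e, Matrix.mul_add, Matrix.mul_add,
    Matrix.add_mul, Matrix.add_mul, one_mul, one_mul, mul_one]
  abel

/-- The positions `r`, `r + 1`, `r + 2`. -/
def threePositions {M : ℕ} (r : ℕ) (hr : r + 2 < M) (k : Fin 3) : Fin M :=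
  ⟨r + k.val, by omega⟩

theorem threePositions_injective {M : ℕ} (r : ℕ) (hr : r + 2 < M) :
    Function.Injective (threePositions r hr) := by
  intro i j h
  simp only [threePositions, Fin.mk.injEq] at h
  omega

theorem embedBlock_threePositions_apply {M : ℕ} (r : ℕ) (hr : r + 2 < M)
    (F : Matrix (Fin 3) (Fin 3) ℂ) (i j : Fin M) :
    embedBlock (threePositions r hr) F i j = (if i = j then 1 else 0) +
      ∑ k : Fin 3, ∑ m : Fin 3, (if i.val = r + k.val then 1 else 0) * (F - 1) k m *
        (if r + m.val = j.val then 1 else 0) := by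
  rw [Finset.sum_comm]
  simp [embedBlock, Matrix.mul_apply, Matrix.one_apply, threePositions, Fin.ext_iff]

/-- Isolates the four block entries as opaque numbers, so that embedding the block is independent of
the formulas in it. -/
theorem STilde_apply {M : ℕ} (l : ℂ) (β : Fin M → ℂ) (γ : ℂ) (r : ℕ) (hr : r + 1 < M) (x : ℂ)
    (i j : Fin M) :
    STilde l β γ r hr x i j =
      if i.val = r ∧ j.val = r then STilde l β γ r hr x ⟨r, Nat.lt_of_succ_lt hr⟩
        ⟨r, Nat.lt_of_succ_lt hr⟩
      else if i.val = r ∧ j.val = r + 1 then STilde l β γ r hr x ⟨r, Nat.lt_of_succ_lt hr⟩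
        ⟨r + 1, hr⟩
      else if i.val = r + 1 ∧ j.val = r then STilde l β γ r hr x ⟨r + 1, hr⟩
        ⟨r, Nat.lt_of_succ_lt hr⟩
      else if i.val = r + 1 ∧ j.val = r + 1 then STilde l β γ r hr x ⟨r + 1, hr⟩ ⟨r + 1, hr⟩
      else if i = j then 1 else 0 := by
  split_ifs with h1 h2 h3 h4 h5
  · obtain ⟨rfl, hj⟩ := h1
    rw [Fin.ext hj (b := ⟨i.val, i.isLt⟩)]
  · congr 1 <;> apply Fin.ext <;> simp [h2]
  · congr 1 <;> apply Fin.ext <;> simp [h3]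
  · congr 1 <;> apply Fin.ext <;> simp [h4]
  · simp only [STilde, Matrix.of_apply, if_neg h1, if_neg h2, if_neg h3, if_neg h4, if_pos h5]
  · simp only [STilde, Matrix.of_apply, if_neg h1, if_neg h2, if_neg h3, if_neg h4, if_neg h5]

theorem STilde_eq_embed_upper {M : ℕ} (l : ℂ) (β : Fin M → ℂ) (γ : ℂ) (r : ℕ) (hr : r + 2 < M)
    (x : ℂ) (hr' : r + 1 < M) :
    STilde l β γ r hr' x = embedBlock (threePositions r hr) (upperBlock
      (STilde l β γ r hr' x ⟨r, Nat.lt_of_succ_lt hr'⟩ ⟨r, Nat.lt_of_succ_lt hr'⟩)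
      (STilde l β γ r hr' x ⟨r, Nat.lt_of_succ_lt hr'⟩ ⟨r + 1, hr'⟩)
      (STilde l β γ r hr' x ⟨r + 1, hr'⟩ ⟨r, Nat.lt_of_succ_lt hr'⟩)
      (STilde l β γ r hr' x ⟨r + 1, hr'⟩ ⟨r + 1, hr'⟩)) := by
  ext i j
  rw [STilde_apply, embedBlock_threePositions_apply]
  generalize STilde l β γ r hr' x ⟨r, Nat.lt_of_succ_lt hr'⟩ ⟨r, Nat.lt_of_succ_lt hr'⟩ = a
  generalize STilde l β γ r hr' x ⟨r, Nat.lt_of_succ_lt hr'⟩ ⟨r + 1, hr'⟩ = b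
  generalize STilde l β γ r hr' x ⟨r + 1, hr'⟩ ⟨r, Nat.lt_of_succ_lt hr'⟩ = c
  generalize STilde l β γ r hr' x ⟨r + 1, hr'⟩ ⟨r + 1, hr'⟩ = d
  simp only [Fin.sum_univ_three, upperBlock, Fin.ext_iff]
  simp
  grind

theorem STilde_eq_embed_lower {M : ℕ} (l : ℂ) (β : Fin M → ℂ) (γ : ℂ) (r : ℕ) (hr : r + 2 < M)
    (x : ℂ) (hr' : r + 1 + 1 < M) :
    STilde l β γ (r + 1) hr' x = embedBlock (threePositions r hr) (lowerBlock
      (STilde l β γ (r + 1) hr' x ⟨r + 1, Nat.lt_of_succ_lt hr'⟩ ⟨r + 1, Nat.lt_of_succ_lt hr'⟩)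
      (STilde l β γ (r + 1) hr' x ⟨r + 1, Nat.lt_of_succ_lt hr'⟩ ⟨r + 1 + 1, hr'⟩)
      (STilde l β γ (r + 1) hr' x ⟨r + 1 + 1, hr'⟩ ⟨r + 1, Nat.lt_of_succ_lt hr'⟩)
      (STilde l β γ (r + 1) hr' x ⟨r + 1 + 1, hr'⟩ ⟨r + 1 + 1, hr'⟩)) := by
  ext i j
  rw [STilde_apply, embedBlock_threePositions_apply]
  generalize STilde l β γ (r + 1) hr' x ⟨r + 1, Nat.lt_of_succ_lt hr'⟩
    ⟨r + 1, Nat.lt_of_succ_lt hr'⟩ = a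
  generalize STilde l β γ (r + 1) hr' x ⟨r + 1, Nat.lt_of_succ_lt hr'⟩ ⟨r + 1 + 1, hr'⟩ = b
  generalize STilde l β γ (r + 1) hr' x ⟨r + 1 + 1, hr'⟩ ⟨r + 1, Nat.lt_of_succ_lt hr'⟩ = c
  generalize STilde l β γ (r + 1) hr' x ⟨r + 1 + 1, hr'⟩ ⟨r + 1 + 1, hr'⟩ = d
  simp only [Fin.sum_univ_three, lowerBlock, Fin.ext_iff]
  simp
  grind

/-! ### The matrices as embedded, gauge-transformed blocks -/

theorem prod_qPow {ι : Type*} (l : ℂ) (β : ι → ℂ) (I : Finset ι) :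
    ∏ i ∈ I, qPow l (β i) = exp (l * ∑ i ∈ I, β i) := by
  simp only [qPow, Finset.mul_sum, exp_sum]

/-- The dictionary from multiplicative to additive notation. Here `exp d = c/(qp)`, and `u^δ = exp
((l δ)(x / l))` explains the value `x / l` of the second spectral variable. -/
theorem STilde_entries {M : ℕ} {l : ℂ} (hl : l.re < 0) (β : Fin M → ℂ) (γ : ℂ) (r : ℕ)
    (hr : r + 1 < M) (x : ℂ) {b₀ b₁ d : ℂ} (hb₀ : l * β ⟨r, Nat.lt_of_succ_lt hr⟩ = b₀)
    (hb₁ : l * β ⟨r + 1, hr⟩ = b₁) (hd : l * (γ - 1 - ∑ i : Fin M with r + 1 < i.val, β i) = d)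
    (gd : QGeneric l d) (gd₀ : QGeneric l (d - b₀)) (gd₁ : QGeneric l (d - b₁))
    (gd₀₁ : QGeneric l (d - b₀ - b₁)) (hx : sigmaTheta l (x + b₀) ≠ 0) :
    STilde l β γ r hr x ⟨r, Nat.lt_of_succ_lt hr⟩ ⟨r, Nat.lt_of_succ_lt hr⟩ =
        (gaugeFactor l b₁ (d - b₀))⁻¹ * faceA l b₀ b₁ d x (x / l) * gaugeFactor l b₀ (d - b₁) ∧
      STilde l β γ r hr x ⟨r, Nat.lt_of_succ_lt hr⟩ ⟨r + 1, hr⟩ =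
        (gaugeFactor l b₁ (d - b₀))⁻¹ * faceB l b₀ x (x / l) * gaugeFactor l b₁ d ∧
      STilde l β γ r hr x ⟨r + 1, hr⟩ ⟨r, Nat.lt_of_succ_lt hr⟩ =
        (gaugeFactor l b₀ d)⁻¹ * faceC l b₀ b₁ d x (x / l) * gaugeFactor l b₀ (d - b₁) ∧
      STilde l β γ r hr x ⟨r + 1, hr⟩ ⟨r + 1, hr⟩ =
        (gaugeFactor l b₀ d)⁻¹ * faceD l b₀ b₁ d x (x / l) * gaugeFactor l b₁ d := by
  have hl0 : l ≠ 0 := by rintro rfl; simp at hl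
  rw [← gauge_faceA (x / l) hl gd₀ gd₁ gd₀₁ hx, ← gauge_faceB (x / l) hl gd gd₀ gd₁ gd₀₁ hx,
    ← gauge_faceC (x / l) hl gd gd₀ gd₁ gd₀₁ hx, ← gauge_faceD (x / l) hl gd gd₀ gd₁ hx]
  have E2 : exp l ^ 2 = exp (2 * l) := by rw [← exp_nat_mul]; push_cast; rfl
  subst hb₀ hb₁ hd
  clear gd gd₀ gd₁ gd₀₁ hx
  dsimp only [STilde, Matrix.of_apply]
  simp only [prod_qPow]
  generalize ∑ i : Fin M with r + 1 < i.val, β i = s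
  generalize β ⟨r, Nat.lt_of_succ_lt hr⟩ = t₀
  generalize β ⟨r + 1, hr⟩ = t₁
  refine ⟨?_, ?_, ?_, ?_⟩
  · rw [if_pos (by simp)]
    simp only [qPow, qPochExp, E2, ← exp_add, ← exp_sub]
    rw [show 2 * l + l * t₀ + l * s - l * γ = l - (l * (γ - 1 - s) - l * t₀) by ring,
      show l * γ - (l + l * t₁ + l * s) = l * (γ - 1 - s) - l * t₁ by ring,
      show x + l * γ - (l + l * t₁ + l * s) = l * (γ - 1 - s) - l * t₁ + x by ring,
      show (-1 - (t₀ + t₁ + s) + γ) * x = (l * (γ - 1 - s) - l * t₀ - l * t₁) *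
        (x / l) by field_simp; ring]
  · rw [if_neg (by simp), if_pos (by simp)]
    simp only [qPow, qPochExp, E2, ← exp_add, ← exp_sub]
    rw [show 2 * l + l * s - l * γ = l - l * (γ - 1 - s) by ring,
      show l + l * t₀ + l * t₁ + l * s - l * γ = -(l * (γ - 1 - s) - l * t₀ - l * t₁) by ring,
      show 2 * l + l * t₀ + l * s - l * γ = l - (l * (γ - 1 - s) - l * t₀) by ring,
      show l + l * t₁ + l * s - l * γ = -(l * (γ - 1 - s) - l * t₁) by ring,
      show -t₀ * x = -(l * t₀) * (x / l) by field_simp]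
  · rw [if_neg (by simp), if_neg (by simp), if_pos (by simp)]
    simp only [qPow, qPochExp, ← exp_add, ← exp_sub]
    rw [show l * γ - (l * t₀ + l * t₁ + l * s) = l - -(l * (γ - 1 - s) - l * t₀ - l * t₁) by ring,
      show l * γ - (l + l * s) = l * (γ - 1 - s) by ring,
      show l * γ - (l * t₀ + l * s) = l - -(l * (γ - 1 - s) - l * t₀) by ring,
      show l * γ - (l + l * t₁ + l * s) = l * (γ - 1 - s) - l * t₁ by ring,
      show -t₁ * x = -(l * t₁) * (x / l) by field_simp]
  · rw [if_neg (by simp), if_neg (by simp), if_neg (by simp),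
      if_pos (by simp)]
    simp only [qPow, qPochExp, ← exp_add, ← exp_sub]
    rw [show l * γ - (l * t₀ + l * s) = l - -(l * (γ - 1 - s) - l * t₀) by ring,
      show l + l * t₁ + l * s - l * γ = -(l * (γ - 1 - s) - l * t₁) by ring,
      show x + l + l * t₀ + l * s - l * γ = -(l * (γ - 1 - s) - l * t₀ - x) by ring,
      show (1 + s - γ) * x = -(l * (γ - 1 - s)) * (x / l) by field_simp; ring]

/-- The product `p` includes position `r + 2`, whence the shift of `d` by `b₂`. The row gauge is the
column gauge of the exchanged parameters, as telescoping requires. -/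
theorem STilde_upper {M : ℕ} {l : ℂ} (hl : l.re < 0) (β : Fin M → ℂ) (γ : ℂ) (r : ℕ)
    (hr : r + 2 < M) (x : ℂ) {b₀ b₁ b₂ d : ℂ}
    (hb₀ : l * β ⟨r, Nat.lt_of_succ_lt (Nat.lt_of_succ_lt hr)⟩ = b₀)
    (hb₁ : l * β ⟨r + 1, Nat.lt_of_succ_lt hr⟩ = b₁) (hb₂ : l * β ⟨r + 2, hr⟩ = b₂)
    (hd : l * (γ - 1 - ∑ i : Fin M with r + 2 < i.val, β i) = d)
    (gd : QGeneric l d) (gd₂ : QGeneric l (d - b₂)) (gd₂₀ : QGeneric l (d - b₂ - b₀))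
    (gd₂₁ : QGeneric l (d - b₂ - b₁)) (gd₂₀₁ : QGeneric l (d - b₂ - b₀ - b₁))
    (hx : sigmaTheta l (x + b₀) ≠ 0) (hr' : r + 1 < M) :
    STilde l β γ r hr' x = embedBlock (threePositions r hr)
      (gaugeTransform (gaugeVec l d b₁ b₀ b₂) (gaugeVec l d b₀ b₁ b₂)
        (faceUpper l b₀ b₁ (d - b₂) x (x / l))) := by
  have hs : (Finset.univ.filter fun i : Fin M => r + 1 < i.val) =
      insert ⟨r + 2, hr⟩ (Finset.univ.filter fun i : Fin M => r + 2 < i.val) := by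
    ext i
    simp only [Finset.mem_filter, Finset.mem_univ, true_and, Finset.mem_insert, Fin.ext_iff]
    omega
  have hd' : l * (γ - 1 - ∑ i : Fin M with r + 1 < i.val, β i) = d - b₂ := by
    rw [hs, Finset.sum_insert (by simp), ← hd, ← hb₂]
    ring
  obtain ⟨hA, hB, hC, hD⟩ := STilde_entries hl β γ r hr' x hb₀ hb₁ hd' gd₂ gd₂₀ gd₂₁ gd₂₀₁ hx
  rw [STilde_eq_embed_upper l β γ r hr x hr', hA, hB, hC, hD,
    upperBlock_gauge (gaugeFactor_ne_zero hl gd gd₂)]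
  rfl

/-- The gauge at the idle position `r` depends on `b₁` and `b₂` only through their sum, so
exchanging them leaves it unchanged. The number `b₀` enters nowhere else and need not come from `β`.
-/
theorem STilde_lower {M : ℕ} {l : ℂ} (hl : l.re < 0) (β : Fin M → ℂ) (γ : ℂ) (r : ℕ)
    (hr : r + 2 < M) (x : ℂ) (b₀ : ℂ) {b₁ b₂ d : ℂ}
    (hb₁ : l * β ⟨r + 1, Nat.lt_of_succ_lt hr⟩ = b₁) (hb₂ : l * β ⟨r + 2, hr⟩ = b₂)
    (hd : l * (γ - 1 - ∑ i : Fin M with r + 2 < i.val, β i) = d)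
    (gd : QGeneric l d) (gd₁ : QGeneric l (d - b₁)) (gd₂ : QGeneric l (d - b₂))
    (gd₁₂ : QGeneric l (d - b₁ - b₂)) (gd₀₁₂ : QGeneric l (d - b₂ - b₁ - b₀))
    (hx : sigmaTheta l (x + b₁) ≠ 0) (hr' : r + 1 + 1 < M) :
    STilde l β γ (r + 1) hr' x = embedBlock (threePositions r hr)
      (gaugeTransform (gaugeVec l d b₀ b₂ b₁) (gaugeVec l d b₀ b₁ b₂)
        (faceLower l b₁ b₂ d x (x / l))) := by
  obtain ⟨hA, hB, hC, hD⟩ := STilde_entries hl β γ (r + 1) hr' x hb₁ hb₂ hd gd gd₁ gd₂ gd₁₂ hx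
  have hk : gaugeFactor l b₀ (d - b₂ - b₁) ≠ 0 :=
    gaugeFactor_ne_zero hl (by rwa [sub_right_comm]) gd₀₁₂
  rw [STilde_eq_embed_lower l β γ r hr x hr', hA, hB, hC, hD, lowerBlock_gauge hk, gaugeVec,
    gaugeVec, sub_right_comm d b₁ b₂]
  rfl

theorem gaugeVec_ne_zero {l d b₀ b₁ b₂ : ℂ} (hl : l.re < 0) (gd : QGeneric l d)
    (gd₂ : QGeneric l (d - b₂)) (gd₂₁ : QGeneric l (d - b₂ - b₁))
    (gd₂₁₀ : QGeneric l (d - b₂ - b₁ - b₀)) (i : Fin 3) : gaugeVec l d b₀ b₁ b₂ i ≠ 0 := by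
  fin_cases i
  · exact gaugeFactor_ne_zero hl gd₂₁ gd₂₁₀
  · exact gaugeFactor_ne_zero hl gd₂ gd₂₁
  · exact gaugeFactor_ne_zero hl gd gd₂

theorem adjSwap_left {M : ℕ} (r : ℕ) (hr : r + 1 < M) (h : r < M) :
    adjSwap r hr ⟨r, h⟩ = ⟨r + 1, hr⟩ :=
  Equiv.swap_apply_left _ _

theorem adjSwap_right {M : ℕ} (r : ℕ) (hr : r + 1 < M) :
    adjSwap r hr ⟨r + 1, hr⟩ = ⟨r, Nat.lt_of_succ_lt hr⟩ :=
  Equiv.swap_apply_right _ _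

theorem adjSwap_of_ne {M : ℕ} {r : ℕ} (hr : r + 1 < M) {i : Fin M} (h : i.val ≠ r)
    (h' : i.val ≠ r + 1) : adjSwap r hr i = i :=
  Equiv.swap_apply_of_ne_of_ne (fun e => h (congrArg Fin.val e)) fun e => h' (congrArg Fin.val e)

/-! ### Genericity from the hypothesis on `c`, and conclusion -/

theorem qGeneric_sub_sum {M : ℕ} {l γ : ℂ} {β : Fin M → ℂ} {r : ℕ}
    (hc : ∀ (I : Finset (Fin M)) (n : ℤ), qPow l γ / ∏ i ∈ I, qPow l (β i) ≠ exp l ^ n)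
    (J : Finset (Fin M)) (hJ : ∀ i ∈ J, i.val ≤ r + 2) :
    QGeneric l (l * (γ - 1 - ∑ i : Fin M with r + 2 < i.val, β i) - ∑ i ∈ J, l * β i) := by
  intro n hn
  have hdisj : Disjoint J (Finset.univ.filter fun i : Fin M => r + 2 < i.val) := by
    rw [Finset.disjoint_left]
    intro i hi hi'
    have h1 := hJ i hi
    have h2 := (Finset.mem_filter.mp hi').2
    omega
  -- The shift to `n + 1` absorbs the factor `q` in `exp d = c/(q ∏ b_i)`.
  refine hc (J ∪ Finset.univ.filter fun i : Fin M => r + 2 < i.val) (n + 1) ?_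
  rw [prod_qPow, Finset.sum_union hdisj, zpow_add_one₀ (exp_ne_zero l), ← hn, qPow, ← exp_sub,
    ← exp_add, ← Finset.mul_sum]
  congr 1
  ring

theorem mainTheorem4 {M : ℕ} (r : ℕ) (hr : r + 2 < M)
    (q lq : ℂ) (hlq : Complex.exp lq = q) (hq : ‖q‖ < 1)
    (β : Fin M → ℂ) (γ : ℂ)
    (hc : ∀ (I : Finset (Fin M)) (n : ℤ), qPow lq γ / ∏ i ∈ I, qPow lq (β i) ≠ q ^ n)
    (u v x y : ℂ) (hu : Complex.exp x = u) (hv : Complex.exp y = v)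
    (hu_pole : ∀ n : ℤ, u * qPow lq (β ⟨r + 1, by omega⟩) ≠ q ^ n)
    (hv_pole : ∀ n : ℤ, v * qPow lq (β ⟨r, by omega⟩) ≠ q ^ n)
    (huv_pole : ∀ n : ℤ, u * v * qPow lq (β ⟨r, by omega⟩) ≠ q ^ n) :
    STilde lq
        (fun i => β (adjSwap r (by omega) (adjSwap (r + 1) (by omega) i))) γ r (by omega) x *
      STilde lq (fun i => β (adjSwap r (by omega) i)) γ (r + 1) (by omega) (x + y) *
      STilde lq β γ r (by omega) y =
    STilde lq
        (fun i => β (adjSwap (r + 1) (by omega) (adjSwap r (by omega) i))) γ (r + 1) (by omega) y *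
      STilde lq (fun i => β (adjSwap (r + 1) (by omega) i)) γ r (by omega) (x + y) *
      STilde lq β γ (r + 1) (by omega) x := by
  subst hlq hu hv
  have hl : lq.re < 0 := by
    rwa [norm_exp, ← Real.exp_zero, Real.exp_lt_exp] at hq
  set a : Fin M := ⟨r, by omega⟩ with ha
  set b : Fin M := ⟨r + 1, by omega⟩ with hb
  set c : Fin M := ⟨r + 2, hr⟩ with hc'
  have hab : a ≠ b := by simp [ha, hb]
  have hac : a ≠ c := by simp [ha, hc']
  have hbc : b ≠ c := by simp [hb, hc']
  have hxB : sigmaTheta lq (x + lq * β b) ≠ 0 :=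
    QGeneric.sigmaTheta_ne_zero hl fun n => by rw [exp_add]; exact hu_pole n
  have hyA : sigmaTheta lq (y + lq * β a) ≠ 0 :=
    QGeneric.sigmaTheta_ne_zero hl fun n => by rw [exp_add]; exact hv_pole n
  have hxyA : sigmaTheta lq (x + y + lq * β a) ≠ 0 :=
    QGeneric.sigmaTheta_ne_zero hl fun n => by rw [exp_add, exp_add]; exact huv_pole n
  have G := qGeneric_sub_sum (r := r) hc
  have g := G ∅ (by simp)
  have gA := G {a} (by simp [ha])
  have gB := G {b} (by simp [hb])
  have gC := G {c} (by simp [hc'])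
  have gAB := G {a, b} (by simp [ha, hb])
  have gAC := G {a, c} (by simp [ha, hc'])
  have gBC := G {b, c} (by simp [hb, hc'])
  have gABC := G {a, b, c} (by simp [ha, hb, hc'])
  rw [Finset.sum_empty, sub_zero] at g
  rw [Finset.sum_singleton] at gA gB gC
  rw [Finset.sum_pair (by assumption), ← sub_sub] at gAB gAC gBC
  rw [Finset.sum_insert (by simp [hab, hac]), Finset.sum_pair hbc, ← sub_sub, ← sub_sub] at gABC
  -- The permutations fix all later positions, so the six matrices share one `d`.
  have hsum : ∀ f : Fin M → Fin M, (∀ i : Fin M, r + 2 < i.val → f i = i) →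
      lq * (γ - 1 - ∑ i : Fin M with r + 2 < i.val, β (f i)) =
        lq * (γ - 1 - ∑ i : Fin M with r + 2 < i.val, β i) := by
    intro f hf
    rw [Finset.sum_congr rfl fun i hi => by rw [hf i (Finset.mem_filter.mp hi).2]]
  generalize hd : lq * (γ - 1 - ∑ i : Fin M with r + 2 < i.val, β i) = d at *
  have ra : ∀ h, adjSwap r h a = b := fun h => adjSwap_left r h _
  have rb : ∀ h, adjSwap r h b = a := fun h => adjSwap_right r h
  have rc : ∀ h, adjSwap r h c = c := fun h => adjSwap_of_ne h (by simp [hc']) (by simp [hc'])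
  have sa : ∀ h, adjSwap (r + 1) h a = a := fun h =>
    adjSwap_of_ne h (by simp [ha]) (by simp only [ha]; omega)
  have sb : ∀ h, adjSwap (r + 1) h b = c := fun h => adjSwap_left (r + 1) h _
  have sc : ∀ h, adjSwap (r + 1) h c = b := fun h => adjSwap_right (r + 1) h
  have ri : ∀ h (i : Fin M), r + 2 < i.val → adjSwap r h i = i := fun h i hi =>
    adjSwap_of_ne h (by omega) (by omega)
  have si : ∀ h (i : Fin M), r + 2 < i.val → adjSwap (r + 1) h i = i := fun h i hi =>
    adjSwap_of_ne h (by omega) (by omega)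
  have gBA : QGeneric lq (d - lq * β b - lq * β a) := by rwa [sub_right_comm]
  have gCA : QGeneric lq (d - lq * β c - lq * β a) := by rwa [sub_right_comm]
  have gCB : QGeneric lq (d - lq * β c - lq * β b) := by rwa [sub_right_comm]
  have gACB : QGeneric lq (d - lq * β a - lq * β c - lq * β b) := by rwa [sub_right_comm]
  have gBAC : QGeneric lq (d - lq * β b - lq * β a - lq * β c) := by
    rwa [sub_right_comm d (lq * β b)]
  have gBCA : QGeneric lq (d - lq * β b - lq * β c - lq * β a) := by rwa [sub_right_comm]
  have gCAB : QGeneric lq (d - lq * β c - lq * β a - lq * β b) := by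
    rwa [sub_right_comm d (lq * β c)]
  have gCBA : QGeneric lq (d - lq * β c - lq * β b - lq * β a) := by rwa [sub_right_comm]
  -- Read from the right, the parameter orders are `abc → bac → bca → cba` on the left side and `abc
  -- → acb → cab → cba` on the right side. Consecutive gauge vectors match and both chains have the
  -- same ends.
  rw [STilde_upper (b₀ := lq * β b) (b₁ := lq * β c) (b₂ := lq * β a) (d := d) hl
      (fun i => β (adjSwap r _ (adjSwap (r + 1) _ i))) γ r hr x (by rw [sa, ra])
      (by rw [sb, rc]) (by rw [sc, rb]) (hsum _ fun i hi => by rw [si _ i hi, ri _ i hi])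
      g gA gAB gAC gABC hxB,
    STilde_lower (b₁ := lq * β a) (b₂ := lq * β c) (d := d) hl
      (fun i => β (adjSwap r _ i)) γ r hr (x + y) (lq * β b) (by rw [rb])
      (by rw [rc]) (hsum _ fun i hi => ri _ i hi) g gA gC gAC gCAB hxyA,
    STilde_upper (b₀ := lq * β a) (b₁ := lq * β b) (b₂ := lq * β c) (d := d) hl
      β γ r hr y rfl rfl rfl hd g gC gCA gCB gCAB hyA,
    STilde_lower (b₁ := lq * β a) (b₂ := lq * β b) (d := d) hl
      (fun i => β (adjSwap (r + 1) _ (adjSwap r _ i))) γ r hr y (lq * β c) (by rw [rb, sa])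
      (by rw [rc, sc]) (hsum _ fun i hi => by rw [ri _ i hi, si _ i hi]) g gA gB gAB gBAC hyA,
    STilde_upper (b₀ := lq * β a) (b₁ := lq * β c) (b₂ := lq * β b) (d := d) hl
      (fun i => β (adjSwap (r + 1) _ i)) γ r hr (x + y) (by rw [sa])
      (by rw [sb]) (by rw [sc]) (hsum _ fun i hi => si _ i hi) g gB gBA gBC gBAC hxyA,
    STilde_lower (b₁ := lq * β b) (b₂ := lq * β c) (d := d) hl
      β γ r hr x (lq * β a) rfl rfl hd g gB gC gBC gCBA hxB]
  have inj := threePositions_injective r hr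
  rw [embedBlock_mul inj, embedBlock_mul inj, embedBlock_mul inj, embedBlock_mul inj,
    gaugeTransform_mul (gaugeVec_ne_zero hl g gA gAC gACB),
    gaugeTransform_mul (gaugeVec_ne_zero hl g gC gCA gCAB),
    gaugeTransform_mul (gaugeVec_ne_zero hl g gB gBA gBAC),
    gaugeTransform_mul (gaugeVec_ne_zero hl g gB gBC gBCA), add_div,
    face_yangBaxter (x / lq) (y / lq) hl hxB hyA hxyA (gA.sigmaTheta_ne_zero hl)
      (gB.sigmaTheta_ne_zero hl) (gC.sigmaTheta_ne_zero hl) (gAB.sigmaTheta_ne_zero hl)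
      (gAC.sigmaTheta_ne_zero hl) (gBC.sigmaTheta_ne_zero hl)]
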